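/- Fix an integer $m\ge 0$, fractions $0=\tau^\star_0<\tau^\star_1<\dots<\tau^\star_m<\tau^\star_{m+1}=1$, means $\mu^\star_0,\dots,\mu^\star_m\in\mathbb R$ with $\mu^\star_k\ne\mu^\star_{k-1}$ for $1\le k\le m$, and $\rho^\star\in(-1,1)$. Let $(\epsilon_i)_{i\in\mathbb Z}$ be i.i.d. real random variables with mean zero and finite variance (for instance Gaussian), and let $(\eta_i)_{i\in\mathbb Z}$ be the stationary AR(1) process solving $\eta_i=\rho^\star\eta_{i-1}+\epsilon_i$. For each $n$ put $t^\star_{n,k}=\lfloor n\tau^\star_k\rfloor$ and observe $y_0=\mu^\star_0+\eta_0$ and $$y_i=\mu^\star_k+\eta_i,\qquad t^\star_{n,k}+1\le i\le t^\star_{n,k+1},\quad 0\le k\le m .$$ Let $\overline\rho_n$ be random variables with $\overline\rho_n-\rho^\star=O_P(n^{-1/2})$, and let $(\Delta_n)$ be a real sequence with $\Delta_n\to\infty$ and, for all large $n$, $\Delta_n\le\min_{0\le k\le m}(t^\star_{n,k+1}-t^\star_{n,k})$ (the latter holds in particular if $\Delta_n/n\to0$). Let $\mathcal A_{n,m}$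 be the set of integer vectors $\boldsymbol t=(t_0,\dots,t_{m+1})$ with $0=t_0<t_1<\dots<t_m<t_{m+1}=n$ and $t_{k+1}-t_k\ge\Delta_n$ for $0\le k\le m$. For all large $n$, let $(\widehat{\boldsymbol\delta}_n,\widehat{\boldsymbol t}_n)$ be any minimizer over $(\boldsymbol\delta,\boldsymbol t)\in\mathbb R^{m+1}\times\mathcal A_{n,m}$ of the least-squares criterion of the decorrelated series $y_i-\overline\rho_ny_{i-1}$, $$\sum_{k=0}^m\ \sum_{i=t_k+1}^{t_{k+1}}\bigl(y_i-\overline\rho_n\,y_{i-1}-\delta_k\bigr)^2,$$ and put $\widehat{\boldsymbol\tau}_n=n^{-1}\widehat{\boldsymbol t}_n$, $\boldsymbol\tau^\star=(\tau^\star_0,\dots,\tau^\star_{m+1})$ and $\delta^\star_k=(1-\rho^\star)\mu^\star_k$, $0\le k\le m$. Then, as $n\to\infty$, $$\widehat{\boldsymbol\tau}_n\to\boldsymbol\tau^\star\ \text{ in probability},\qquad \|\widehat{\boldsymbol\tau}_n-\boldsymbol\tau^\star\|_\infty=O_P(n^{-1}),\qquad \|\widehat{\boldsymbol\delta}_n-\boldsymbol\delta^\star\|=O_P(n^{-1/2}),$$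 where $\|\cdot\|$ is the Euclidean norm. -/

import Mathlib

open MeasureTheory ProbabilityTheory Filter Topology

namespace AR1Seg

/-- `X n = O_P(a n)`: for every `ε > 0` there are `M` and `N` such that
`P(|X n| > M * a n) ≤ ε` for all `n ≥ N`. -/
def IsBigOP {Ω : Type*} [MeasurableSpace Ω] (P : Measure Ω) (X : ℕ → Ω → ℝ) (a : ℕ → ℝ) : Prop :=
  ∀ ε : ℝ, 0 < ε → ∃ M : ℝ, ∀ᶠ n in atTop, P {ω | M * a n < |X n ω|} ≤ ENNReal.ofReal ε

/-- `ε` is a sequence of i.i.d. centred real random variables with finite variance. -/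
structure IsIIDNoise {Ω : Type*} [MeasurableSpace Ω] (P : Measure Ω) (ε : ℤ → Ω → ℝ) : Prop where
  measurable : ∀ i, Measurable (ε i)
  indep : iIndepFun ε P
  identDistrib : ∀ i, IdentDistrib (ε i) (ε 0) P P
  memLp : MemLp (ε 0) 2 P
  mean_zero : ∫ ω, ε 0 ω ∂P = 0

/-- `η` is a (strictly) stationary solution of `η i = ρ * η (i - 1) + ε i`, `i ∈ ℤ`. -/
structure IsStationaryAR1 {Ω : Type*} [MeasurableSpace Ω] (P : Measure Ω) (ρ : ℝ)
    (ε η : ℤ → Ω → ℝ) : Prop where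
  measurable : ∀ i, Measurable (η i)
  recursion : ∀ i, ∀ᵐ ω ∂P, η i ω = ρ * η (i - 1) ω + ε i ω
  stationary : ∀ h : ℤ, IdentDistrib (fun ω i => η (i + h) ω) (fun ω i => η i ω) P P

/-- The change-points `t⋆_{n,k} = ⌊n τ⋆_k⌋`, `0 ≤ k ≤ m + 1`. -/
noncomputable def changePoint {m : ℕ} (τ : Fin (m + 2) → ℝ) (n : ℕ) (k : Fin (m + 2)) : ℕ :=
  ⌊(n : ℝ) * τ k⌋₊

/-- `y n 0, …, y n n` are the observations of the piecewise constant mean model at sample size `n`: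
`y n i = μ k + η i` for `t⋆_{n,k} < i ≤ t⋆_{n,k+1}`, and `y n 0 = μ 0 + η 0`. -/
def IsObservation {Ω : Type*} {m : ℕ} (τ : Fin (m + 2) → ℝ) (μ : Fin (m + 1) → ℝ)
    (η : ℤ → Ω → ℝ) (y : ℕ → ℕ → Ω → ℝ) : Prop :=
  ∀ (n : ℕ) (ω : Ω), y n 0 ω = μ 0 + η 0 ω ∧
    ∀ (k : Fin (m + 1)) (i : ℕ), changePoint τ n k.castSucc < i → i ≤ changePoint τ n k.succ →
      y n i ω = μ k + η i ω

/-- The set of segmentations `0 = t_0 < t_1 < … < t_{m+1} = n` of `{1, …, n}` into `m + 1` segments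
of length at least `Δ`. -/
def admissible (m n : ℕ) (Δ : ℝ) : Set (Fin (m + 2) → ℕ) :=
  {t | t 0 = 0 ∧ t (Fin.last (m + 1)) = n ∧
    ∀ k : Fin (m + 1), t k.castSucc < t k.succ ∧ Δ ≤ (t k.succ : ℝ) - (t k.castSucc : ℝ)}

/-- The least-squares criterion of the series decorrelated with parameter `ρ`:
`∑_k ∑_{t_k < i ≤ t_{k+1}} (y_i - ρ y_{i-1} - δ_k)²`. -/
def criterion {m : ℕ} (y : ℕ → ℝ) (ρ : ℝ) (δ : Fin (m + 1) → ℝ) (t : Fin (m + 2) → ℕ) : ℝ :=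
  ∑ k : Fin (m + 1), ∑ i ∈ Finset.Ioc (t k.castSucc) (t k.succ), (y i - ρ * y (i - 1) - δ k) ^ 2

/-- `(δ, t)` minimizes the criterion over `ℝ^{m+1} × 𝒜_{n,m}`. -/
def IsArgmin {m : ℕ} (n : ℕ) (Δ : ℝ) (y : ℕ → ℝ) (ρ : ℝ) (δ : Fin (m + 1) → ℝ)
    (t : Fin (m + 2) → ℕ) : Prop :=
  t ∈ admissible m n Δ ∧
    ∀ (δ' : Fin (m + 1) → ℝ), ∀ t' ∈ admissible m n Δ, criterion y ρ δ t ≤ criterion y ρ δ' t'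

end AR1Seg

/-! The argument separates a deterministic analysis of least squares from a probabilistic check that
the data are well behaved.

Deterministic part. Let z be a piecewise constant signal plus noise, where noise sums over intervals
are at most A√n and noise sums started at a true change-point, in either direction, stay below a
line κ·length + B of small slope. Comparing the minimizer with the truth, the squared error of the
fit is O(√n + n/Δ) = o(n) (`IsTameSample.sum_sq_le`). A true change-point with no estimate within γn
would cost order n (`IsTameSample.le_sum_sq`), so the estimates are within γn of the truth and the
levels are nearly right. Keeping the fitted levels and moving only the change-points back to the
truth, a displacement L saves at least Ld²/4 up to a constant, since the noise gains at most a line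
of smaller slope. Hence the displacements are bounded (`IsTameSample.abs_changePoint_sub_le`), and
segment means then give levels at rate n^{-1/2}.

Probabilistic part. With signal (1 - ρ')μ_k, where ρ' is the estimated autocorrelation, partial sums
of the noise of y_i - ρ'y_{i-1} are those of the innovations plus a bounded remainder: (ρ - ρ')
times a sum of the AR path is n^{-1/2}·O(√n), and the effect of the jumps of the mean telescopes
(`sum_decorrelated_eq`, `isTameSample_of_path`). Only i.i.d. sums then need control: Kolmogorov's
inequality gives the √n bound, and its dyadic version gives the lines. -/

section MaximalInequality

/-! ### Kolmogorov's maximal inequality and its consequences for linear boundaries. -/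

variable {Ω : Type*} [MeasurableSpace Ω] {P : Measure Ω}

/-- The cross term of the expanded square vanishes over any event `s` of the past: the indicator of
`s` times the partial sum is known at time `n`, hence independent of the centred variable `X (n +
1)`. General `s` yields the submartingale property, `s = univ` the variance. -/
theorem setIntegral_sq_sum_succ [IsProbabilityMeasure P] {X : ℕ → Ω → ℝ}
    (hX : ∀ i, StronglyMeasurable (X i)) (hind : iIndepFun X P) (hL : ∀ i, MemLp (X i) 2 P)
    (h0 : ∀ i, ∫ ω, X i ω ∂P = 0) (n : ℕ) {s : Set Ω}
    (hs : MeasurableSet[Filtration.natural X hX n] s) :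
    ∫ ω in s, (∑ i ∈ Finset.range (n + 2), X i ω) ^ 2 ∂P =
      ∫ ω in s, (∑ i ∈ Finset.range (n + 1), X i ω) ^ 2 ∂P + ∫ ω in s, X (n + 1) ω ^ 2 ∂P := by
  have hsm : MeasurableSet s := (Filtration.natural X hX).le n s hs
  have hSL : MemLp (fun ω => ∑ i ∈ Finset.range (n + 1), X i ω) 2 P :=
    memLp_finsetSum _ fun i _ => hL i
  have hS : Measurable[Filtration.natural X hX n] fun ω => ∑ i ∈ Finset.range (n + 1), X i ω := by
    refine Finset.measurable_fun_sum _ fun i hi => ?_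
    have hle : i ≤ n := Nat.lt_succ_iff.1 (Finset.mem_range.1 hi)
    exact ((Filtration.stronglyAdapted_natural hX i).mono
      ((Filtration.natural X hX).mono hle)).measurable
  have hSX : Integrable (fun ω => (∑ i ∈ Finset.range (n + 1), X i ω) * X (n + 1) ω) P :=
    hSL.integrable_mul (hL (n + 1))
  have hcross : ∫ ω in s, (∑ i ∈ Finset.range (n + 1), X i ω) * X (n + 1) ω ∂P = 0 := by
    have hI := hind.indep_comap_natural_of_lt hX (Nat.lt_succ_self n)
    have hg : Measurable[Filtration.natural X hX n]
        (s.indicator fun ω => ∑ i ∈ Finset.range (n + 1), X i ω) := hS.indicator hs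
    have hIF : IndepFun (s.indicator fun ω => ∑ i ∈ Finset.range (n + 1), X i ω) (X (n + 1)) P := by
      rw [IndepFun_iff_Indep]
      exact indep_of_indep_of_le_left hI.symm hg.comap_le
    have := hIF.integral_fun_mul_eq_mul_integral
      (hg.mono ((Filtration.natural X hX).le n) le_rfl).aestronglyMeasurable
      (hX (n + 1)).aestronglyMeasurable
    rw [h0, mul_zero] at this
    rw [← this, ← integral_indicator hsm]
    congr 1
    ext ω
    by_cases h : ω ∈ s <;> simp [h]
  have e : ∀ ω, (∑ i ∈ Finset.range (n + 2), X i ω) ^ 2 =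
      (∑ i ∈ Finset.range (n + 1), X i ω) ^ 2 +
        (2 * ((∑ i ∈ Finset.range (n + 1), X i ω) * X (n + 1) ω) + X (n + 1) ω ^ 2) := by
    intro ω
    rw [Finset.sum_range_succ _ (n + 1)]
    ring
  simp_rw [e]
  have hrest : Integrable (fun ω => 2 * ((∑ i ∈ Finset.range (n + 1), X i ω) * X (n + 1) ω) +
      X (n + 1) ω ^ 2) P := (hSX.const_mul 2).add (hL (n + 1)).integrable_sq
  rw [integral_add hSL.integrable_sq.integrableOn hrest.integrableOn,
    integral_add (hSX.const_mul 2).integrableOn (hL _).integrable_sq.integrableOn,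
    integral_const_mul, hcross]
  ring

/-- Kolmogorov's maximal inequality. -/
theorem measure_exists_le_abs_sum_le [IsProbabilityMeasure P] {X : ℕ → Ω → ℝ}
    (hX : ∀ i, Measurable (X i)) (hind : iIndepFun X P) (hL : ∀ i, MemLp (X i) 2 P)
    (h0 : ∀ i, ∫ ω, X i ω ∂P = 0) {v : ℝ} (hv : ∀ i, ∫ ω, X i ω ^ 2 ∂P ≤ v) {a : ℝ} (ha : 0 < a)
    (n : ℕ) :
    P {ω | ∃ j ≤ n, a ≤ |∑ i ∈ Finset.range j, X i ω|} ≤ ENNReal.ofReal (n * v / a ^ 2) := by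
  have hX' : ∀ i, StronglyMeasurable (X i) := fun i => (hX i).stronglyMeasurable
  -- Doob's inequality will cover sums of 1 to n + 1 terms, since `f k` has `k + 1` terms; the empty
  -- sum is excluded by `0 < a`.
  rcases n with _ | n
  · simp [ha.not_ge]
  set f : ℕ → Ω → ℝ := fun k ω => (∑ i ∈ Finset.range (k + 1), X i ω) ^ 2 with hf
  have hSL : ∀ k, MemLp (fun ω => ∑ i ∈ Finset.range (k + 1), X i ω) 2 P :=
    fun k => memLp_finsetSum _ fun i _ => hL i
  have hsub : Submartingale f (Filtration.natural X hX') P := by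
    refine submartingale_of_setIntegral_le_succ ?_ (fun k => (hSL k).integrable_sq) ?_
    · intro k
      refine StronglyMeasurable.pow ?_ 2
      refine Finset.stronglyMeasurable_fun_sum _ fun i hi => ?_
      exact (Filtration.stronglyAdapted_natural hX' i).mono
        ((Filtration.natural X hX').mono (Nat.lt_succ_iff.1 (Finset.mem_range.1 hi)))
    · intro k s hs
      rw [setIntegral_sq_sum_succ hX' hind hL h0 k hs]
      have : 0 ≤ ∫ ω in s, X (k + 1) ω ^ 2 ∂P := integral_nonneg fun ω => sq_nonneg _
      linarith
  have hint : ∀ k, ∫ ω, f k ω ∂P ≤ ((k + 1 : ℕ) : ℝ) * v := by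
    intro k
    induction k with
    | zero => simpa [hf] using hv 0
    | succ k ih =>
      have := setIntegral_sq_sum_succ hX' hind hL h0 k (s := Set.univ) MeasurableSet.univ
      simp only [Measure.restrict_univ] at this
      simp only [hf] at ih ⊢
      rw [this]
      have := hv (k + 1)
      push_cast at ih ⊢
      linarith
  have hmax := maximal_ineq hsub (fun k ω => sq_nonneg _) (ε := ⟨a ^ 2, sq_nonneg a⟩) n
  set E : Set Ω := {ω | a ^ 2 ≤ (Finset.range (n + 1)).sup' Finset.nonempty_range_add_one
    fun k => f k ω} with hE
  have hincl : {ω | ∃ j ≤ n + 1, a ≤ |∑ i ∈ Finset.range j, X i ω|} ⊆ E := by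
    rintro ω ⟨j, hj, hja⟩
    rcases j with _ | j
    · simp at hja
      linarith
    · simp only [hE, Set.mem_ofPred_eq, Finset.le_sup'_iff]
      refine ⟨j, Finset.mem_range.2 (by omega), ?_⟩
      simp only [hf]
      rw [← sq_abs (∑ i ∈ Finset.range (j + 1), X i ω)]
      exact pow_le_pow_left₀ ha.le hja 2
  refine (measure_mono hincl).trans ?_
  have ha2 : 0 < a ^ 2 := by positivity
  have h1 : ENNReal.ofReal (a ^ 2) * P E ≤ ENNReal.ofReal (((n + 1 : ℕ) : ℝ) * v) := by
    refine le_trans (le_of_eq ?_) (hmax.trans (ENNReal.ofReal_le_ofReal ?_))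
    · rw [ENNReal.ofReal_eq_coe_nnreal ha2.le]
      rfl
    · exact (setIntegral_le_integral (hSL n).integrable_sq
        (ae_of_all _ fun ω => sq_nonneg _)).trans (hint n)
  rw [ENNReal.ofReal_div_of_pos ha2, ENNReal.le_div_iff_mul_le (Or.inl (by simpa using ha.ne'))
    (Or.inl ENNReal.ofReal_ne_top), mul_comm]
  exact h1

/-- Partial sums of centred independent variables with bounded variances stay below a line of
positive slope, with a probability that only depends on the variance bound. -/
theorem exists_measure_lt_abs_sum_le {v κ e : ℝ} (hv0 : 0 ≤ v) (hκ : 0 < κ) (he : 0 < e) :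
    ∃ B : ℝ, 0 < B ∧ ∀ {Ω : Type*} [MeasurableSpace Ω] (P : Measure Ω) [IsProbabilityMeasure P]
      (X : ℕ → Ω → ℝ), (∀ i, Measurable (X i)) → iIndepFun X P → (∀ i, MemLp (X i) 2 P) →
      (∀ i, ∫ ω, X i ω ∂P = 0) → (∀ i, ∫ ω, X i ω ^ 2 ∂P ≤ v) →
      P {ω | ∃ j : ℕ, κ * j + B < |∑ i ∈ Finset.range j, X i ω|} ≤ ENNReal.ofReal e := by
  -- The dyadic blocks below contribute 4v / (κ²2^J) in total; `J` makes this at most `e`.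
  obtain ⟨J, hJ⟩ := pow_unbounded_of_one_lt (4 * v / κ ^ 2 / e) (one_lt_two : (1 : ℝ) < 2)
  refine ⟨κ * 2 ^ J, by positivity, ?_⟩
  intro Ω _ P _ X hX hind hL h0 hv
  -- Dyadic peeling: for `j` between 2^(J+l) and 2^(J+l+1) the line is above κ2^(J+l). Indices up to
  -- 2^J fall in block `l = 0`, thanks to the intercept.
  have hincl : {ω | ∃ j : ℕ, κ * j + κ * 2 ^ J < |∑ i ∈ Finset.range j, X i ω|} ⊆
      ⋃ l : ℕ, {ω | ∃ j ≤ 2 ^ (J + l + 1), κ * 2 ^ (J + l) ≤ |∑ i ∈ Finset.range j, X i ω|} := by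
    rintro ω ⟨j, hj⟩
    simp only [Set.mem_iUnion, Set.mem_ofPred_eq]
    rcases le_total j (2 ^ J) with h | h
    · refine ⟨0, j, h.trans (Nat.pow_le_pow_right two_pos (by omega)), ?_⟩
      have : 0 ≤ κ * (j : ℝ) := by positivity
      simp only [add_zero]
      linarith
    · have hj0 : j ≠ 0 := by
        have := Nat.pow_pos (n := J) two_pos
        omega
      have hl : J ≤ Nat.log 2 j := Nat.le_log_of_pow_le one_lt_two h
      refine ⟨Nat.log 2 j - J, j, ?_, ?_⟩
      · rw [Nat.add_sub_cancel' hl]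
        exact (Nat.lt_pow_succ_log_self one_lt_two j).le
      · rw [Nat.add_sub_cancel' hl]
        have h1 : ((2 ^ Nat.log 2 j : ℕ) : ℝ) ≤ j := by
          exact_mod_cast Nat.pow_log_le_self 2 hj0
        push_cast at h1
        have h2 : κ * 2 ^ Nat.log 2 j ≤ κ * j := mul_le_mul_of_nonneg_left h1 hκ.le
        have h3 : 0 < κ * (2 : ℝ) ^ J := by positivity
        linarith
  have hc : 0 ≤ v / (κ ^ 2 * 2 ^ J) := by positivity
  have hs : HasSum (fun l : ℕ => 2 * (v / (κ ^ 2 * 2 ^ J)) * (1 / 2) ^ l)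
      (2 * (v / (κ ^ 2 * 2 ^ J)) * 2) := hasSum_geometric_two.mul_left _
  calc P {ω | ∃ j : ℕ, κ * j + κ * 2 ^ J < |∑ i ∈ Finset.range j, X i ω|}
      ≤ ∑' l : ℕ, P {ω | ∃ j ≤ 2 ^ (J + l + 1),
          κ * 2 ^ (J + l) ≤ |∑ i ∈ Finset.range j, X i ω|} :=
        (measure_mono hincl).trans (measure_iUnion_le _)
    _ ≤ ∑' l : ℕ, ENNReal.ofReal (2 * (v / (κ ^ 2 * 2 ^ J)) * (1 / 2) ^ l) := by
        refine ENNReal.tsum_le_tsum fun l => ?_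
        refine (measure_exists_le_abs_sum_le hX hind hL h0 hv (by positivity) _).trans
          (ENNReal.ofReal_le_ofReal (le_of_eq ?_))
        push_cast
        rw [pow_add, pow_add, one_div, inv_pow]
        field_simp
    _ = ENNReal.ofReal (2 * (v / (κ ^ 2 * 2 ^ J)) * 2) := by
        rw [← ENNReal.ofReal_tsum_of_nonneg (fun l => by positivity) hs.summable, hs.tsum_eq]
    _ ≤ ENNReal.ofReal e := by
        refine ENNReal.ofReal_le_ofReal ?_
        rw [div_div, div_lt_iff₀ (by positivity)] at hJ
        rw [show 2 * (v / (κ ^ 2 * 2 ^ J)) * 2 = 4 * v / (κ ^ 2 * 2 ^ J) by ring,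
          div_le_iff₀ (by positivity)]
        nlinarith

/-- A real random variable is tight. -/
theorem exists_measure_lt_abs_le [IsFiniteMeasure P] {Y : Ω → ℝ} (hY : Measurable Y) {e : ℝ}
    (he : 0 < e) : ∃ A : ℝ, 0 < A ∧ P {ω | A < |Y ω|} ≤ ENNReal.ofReal e := by
  have hlim : Tendsto (fun n : ℕ => P {ω | (n : ℝ) < |Y ω|}) atTop
      (𝓝 (P (⋂ n : ℕ, {ω | (n : ℝ) < |Y ω|}))) := by
    refine tendsto_measure_iInter_atTop
      (fun n => (measurableSet_lt measurable_const hY.abs).nullMeasurableSet) ?_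
      ⟨0, measure_ne_top _ _⟩
    intro a b hab ω (hω : (b : ℝ) < |Y ω|)
    exact lt_of_le_of_lt (Nat.cast_le.2 hab) hω
  have hempty : (⋂ n : ℕ, {ω | (n : ℝ) < |Y ω|}) = ∅ := by
    ext ω
    simp only [Set.mem_iInter, Set.mem_ofPred_eq, Set.mem_empty_iff_false, iff_false, not_forall,
      not_lt]
    exact exists_nat_ge _
  rw [hempty, measure_empty] at hlim
  have := (hlim.eventually_le_const (ENNReal.ofReal_pos.2 he)).and (eventually_gt_atTop 0)
  obtain ⟨n, hn, hpos⟩ := this.exists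
  exact ⟨n, by exact_mod_cast hpos, hn⟩

end MaximalInequality

namespace AR1Seg

/-! ### Deterministic analysis of least-squares segmentation. -/

section Segments

variable {m : ℕ}

theorem sum_Ioc_eq_sub {f : ℕ → ℝ} {a b : ℕ} (h : a ≤ b) :
    ∑ i ∈ Finset.Ioc a b, f i = ∑ i ∈ Finset.Ioc 0 b, f i - ∑ i ∈ Finset.Ioc 0 a, f i := by
  rw [← Finset.sum_Ioc_consecutive f (Nat.zero_le a) h]
  ring

/-- Summation by parts over a segmentation. -/
theorem sum_sum_segments {t : Fin (m + 2) → ℕ} (ht : ∀ k : Fin (m + 1), t k.castSucc ≤ t k.succ)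
    (f : Fin (m + 1) → ℕ → ℝ) :
    ∑ k : Fin (m + 1), ∑ i ∈ Finset.Ioc (t k.castSucc) (t k.succ), f k i =
      ∑ i ∈ Finset.Ioc 0 (t (Fin.last (m + 1))), f (Fin.last m) i
        - ∑ i ∈ Finset.Ioc 0 (t 0), f 0 i
        + ∑ k : Fin m, (∑ i ∈ Finset.Ioc 0 (t k.castSucc.succ), f k.castSucc i
            - ∑ i ∈ Finset.Ioc 0 (t k.castSucc.succ), f k.succ i) := by
  rw [Finset.sum_congr rfl fun k _ => sum_Ioc_eq_sub (f := f k) (ht k), Finset.sum_sub_distrib,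
    Fin.sum_univ_castSucc, Fin.sum_univ_succ (fun k : Fin (m + 1) =>
      ∑ i ∈ Finset.Ioc 0 (t k.castSucc), f k i), Finset.sum_sub_distrib]
  simp only [Fin.succ_castSucc, Fin.succ_last, Fin.castSucc_zero]
  ring

theorem sum_segments {t : Fin (m + 2) → ℕ} (ht : ∀ k : Fin (m + 1), t k.castSucc ≤ t k.succ)
    (h0 : t 0 = 0) (f : ℕ → ℝ) :
    ∑ k : Fin (m + 1), ∑ i ∈ Finset.Ioc (t k.castSucc) (t k.succ), f i =
      ∑ i ∈ Finset.Ioc 0 (t (Fin.last (m + 1))), f i := by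
  rw [sum_sum_segments ht fun _ => f]
  simp [h0]

theorem exists_segment {t : Fin (m + 2) → ℕ} {i : ℕ} (h0 : t 0 < i)
    (h1 : i ≤ t (Fin.last (m + 1))) :
    ∃ k : Fin (m + 1), t k.castSucc < i ∧ i ≤ t k.succ := by
  by_contra! h
  have : ∀ k : Fin (m + 2), t k < i := by
    intro k
    induction k using Fin.induction with
    | zero => exact h0
    | succ k ih => exact h k ih
  exact absurd (this (Fin.last (m + 1))) (not_lt.2 h1)

/-- Two segmentations such that each change-point of the first is within `r` of a change-point of
the second are within `r` of each other if the change-points of the first are `2 * r` apart. -/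
theorem abs_sub_lt_of_forall_exists {N : ℕ} {s t : Fin N → ℝ} (ht : StrictMono t) {r : ℝ}
    (hgap : ∀ k l, k < l → s k + 2 * r ≤ s l) (h : ∀ k, ∃ j, |t j - s k| < r) (k : Fin N) :
    |t k - s k| < r := by
  choose f hf using h
  have hmono : StrictMono f := by
    intro k l hkl
    have h1 := abs_lt.1 (hf k)
    have h2 := abs_lt.1 (hf l)
    have h3 := hgap k l hkl
    exact ht.lt_iff_lt.1 (by linarith)
  -- A strictly increasing self-map of `Fin N` is the identity.
  have hk : f k = k := le_antisymm hmono.apply_le hmono.le_apply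
  have := hf k
  rwa [hk] at this

/-- The residual sum of squares of the piecewise constant fit with values `δ` and
change-points `t`. -/
def rss (z : ℕ → ℝ) (δ : Fin (m + 1) → ℝ) (t : Fin (m + 2) → ℕ) : ℝ :=
  ∑ k : Fin (m + 1), ∑ i ∈ Finset.Ioc (t k.castSucc) (t k.succ), (z i - δ k) ^ 2

/-- The optimal value on a segment is the mean of the segment. -/
theorem mul_card_eq_sum_of_forall_rss_le {z : ℕ → ℝ} {δ : Fin (m + 1) → ℝ} {t : Fin (m + 2) → ℕ}
    (ht : ∀ k : Fin (m + 1), t k.castSucc < t k.succ) (h : ∀ δ', rss z δ t ≤ rss z δ' t)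
    (k : Fin (m + 1)) :
    δ k * ((t k.succ : ℝ) - t k.castSucc) = ∑ i ∈ Finset.Ioc (t k.castSucc) (t k.succ), z i := by
  set I := Finset.Ioc (t k.castSucc) (t k.succ) with hI
  have hlen : (I.card : ℝ) = (t k.succ : ℝ) - t k.castSucc := by
    rw [hI, Nat.card_Ioc, Nat.cast_sub (ht k).le]
  have hpos : (0 : ℝ) < (t k.succ : ℝ) - t k.castSucc := by
    have : (t k.castSucc : ℝ) < t k.succ := by exact_mod_cast ht k
    linarith
  set L := (t k.succ : ℝ) - t k.castSucc with hL
  set x := (∑ i ∈ I, z i) / L with hx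
  have hxL : x * L = ∑ i ∈ I, z i := div_mul_cancel₀ _ hpos.ne'
  have hle : ∑ i ∈ I, (z i - δ k) ^ 2 ≤ ∑ i ∈ I, (z i - x) ^ 2 := by
    have h1 := h (Function.update δ k x)
    unfold rss at h1
    rw [← Finset.add_sum_erase _ _ (Finset.mem_univ k),
      ← Finset.add_sum_erase _ _ (Finset.mem_univ k), Function.update_self] at h1
    have h2 : ∑ l ∈ Finset.univ.erase k, ∑ i ∈ Finset.Ioc (t l.castSucc) (t l.succ),
        (z i - Function.update δ k x l) ^ 2 =
        ∑ l ∈ Finset.univ.erase k, ∑ i ∈ Finset.Ioc (t l.castSucc) (t l.succ), (z i - δ l) ^ 2 := by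
      refine Finset.sum_congr rfl fun l hl => ?_
      rw [Function.update_of_ne (Finset.ne_of_mem_erase hl)]
    rw [h2] at h1
    linarith
  have hexp : ∀ c : ℝ, ∑ i ∈ I, (z i - c) ^ 2 =
      ∑ i ∈ I, z i ^ 2 - 2 * c * ∑ i ∈ I, z i + L * c ^ 2 := by
    intro c
    rw [Finset.mul_sum, ← Finset.sum_sub_distrib, ← hlen, ← nsmul_eq_mul, ← Finset.sum_const,
      ← Finset.sum_add_distrib]
    exact Finset.sum_congr rfl fun i _ => by ring
  rw [hexp, hexp, ← hxL] at hle
  have h3 : L * (δ k - x) ^ 2 ≤ 0 := by nlinarith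
  have h4 : (δ k - x) ^ 2 ≤ 0 := by
    by_contra! hc
    have := mul_pos hpos hc
    linarith
  have h5 : δ k - x = 0 := pow_eq_zero_iff two_ne_zero |>.1 (le_antisymm h4 (sq_nonneg _))
  rw [← hxL, sub_eq_zero.1 h5]

/-- A signal `b` of length `n`, piecewise constant with values `ν` and change-points `s`, observed
as `z` with a noise `z - b` whose partial sums are controlled. The constants `C`, `d` bound the
values and the jumps of the signal and `c` the relative length of its segments. -/
structure IsTameSample (n : ℕ) (s : Fin (m + 2) → ℕ) (ν : Fin (m + 1) → ℝ) (z b : ℕ → ℝ)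
    (c C d A κ B : ℝ) : Prop where
  zero : s 0 = 0
  last : s (Fin.last (m + 1)) = n
  le : ∀ k : Fin (m + 1), s k.castSucc ≤ s k.succ
  gap : ∀ k : Fin (m + 1), c * n ≤ (s k.succ : ℝ) - s k.castSucc
  signal : ∀ (k : Fin (m + 1)) (i : ℕ), s k.castSucc < i → i ≤ s k.succ → b i = ν k
  bound : ∀ k, |ν k| ≤ C
  jump : ∀ k : Fin m, d ≤ |ν k.castSucc - ν k.succ|
  noise : ∀ p q, p ≤ q → q ≤ n → |∑ i ∈ Finset.Ioc p q, (z i - b i)| ≤ A * √n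
  noise_left : ∀ (k : Fin m) (p : ℕ), p ≤ s k.castSucc.succ →
    |∑ i ∈ Finset.Ioc p (s k.castSucc.succ), (z i - b i)| ≤ κ * ((s k.castSucc.succ : ℝ) - p) + B
  noise_right : ∀ (k : Fin m) (q : ℕ), s k.castSucc.succ ≤ q → q ≤ n →
    |∑ i ∈ Finset.Ioc (s k.castSucc.succ) q, (z i - b i)| ≤ κ * ((q : ℝ) - s k.castSucc.succ) + B

variable {n : ℕ} {s : Fin (m + 2) → ℕ} {ν : Fin (m + 1) → ℝ} {z b : ℕ → ℝ} {c C d A κ B : ℝ}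
  {t : Fin (m + 2) → ℕ} {δ : Fin (m + 1) → ℝ}

theorem IsTameSample.abs_signal_le (h : IsTameSample n s ν z b c C d A κ B) {i : ℕ} (h0 : 0 < i)
    (hn : i ≤ n) : |b i| ≤ C := by
  obtain ⟨k, h1, h2⟩ := exists_segment (t := s) (by rwa [h.zero]) (by rwa [h.last])
  rw [h.signal k i h1 h2]
  exact h.bound k

theorem changePoint_le_of_segments (ht : ∀ k : Fin (m + 1), t k.castSucc < t k.succ)
    (htn : t (Fin.last (m + 1)) = n) (k : Fin (m + 2)) : t k ≤ n := by
  have : StrictMono t := Fin.strictMono_iff_lt_succ.2 ht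
  rw [← htn]
  exact this.monotone (Fin.le_last k)

/-- A segment mean is a mean of the signal plus noise of size A√n spread over at least Δ points. In
the basic inequality this bound is multiplied by √n, giving √n + n/Δ, which is o(n) as soon as Δ
tends to infinity. -/
theorem IsTameSample.abs_fit_le (h : IsTameSample n s ν z b c C d A κ B) {Δ : ℝ} (hΔ : 0 < Δ)
    (hA : 0 ≤ A) (ht : t ∈ admissible m n Δ)
    (hmean : ∀ k : Fin (m + 1), δ k * ((t k.succ : ℝ) - t k.castSucc) =
      ∑ i ∈ Finset.Ioc (t k.castSucc) (t k.succ), z i) (k : Fin (m + 1)) :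
    |δ k| ≤ C + A * √n / Δ := by
  obtain ⟨h0, hl, hseg⟩ := ht
  have hn := changePoint_le_of_segments (fun k => (hseg k).1) hl
  set L := (t k.succ : ℝ) - t k.castSucc with hL
  have hΔL : Δ ≤ L := (hseg k).2
  have hLpos : 0 < L := hΔ.trans_le hΔL
  have hcard : ((Finset.Ioc (t k.castSucc) (t k.succ)).card : ℝ) = L := by
    rw [Nat.card_Ioc, Nat.cast_sub (hseg k).1.le]
  have hb : |∑ i ∈ Finset.Ioc (t k.castSucc) (t k.succ), b i| ≤ L * C := by
    refine (Finset.abs_sum_le_sum_abs _ _).trans ?_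
    rw [← hcard, ← nsmul_eq_mul]
    refine Finset.sum_le_card_nsmul _ _ _ fun i hi => ?_
    obtain ⟨hi1, hi2⟩ := Finset.mem_Ioc.1 hi
    exact h.abs_signal_le (by omega) (hi2.trans (hn _))
  have hw := h.noise _ _ (hseg k).1.le (hn _)
  have h1 : |δ k| * L ≤ L * C + A * √n := by
    rw [← abs_of_pos hLpos, ← abs_mul, hmean k, abs_of_pos hLpos]
    calc |∑ i ∈ Finset.Ioc (t k.castSucc) (t k.succ), z i|
        = |∑ i ∈ Finset.Ioc (t k.castSucc) (t k.succ), b i +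
            ∑ i ∈ Finset.Ioc (t k.castSucc) (t k.succ), (z i - b i)| := by
          rw [← Finset.sum_add_distrib]
          simp
      _ ≤ _ := (abs_add_le _ _).trans (add_le_add hb hw)
  have h2 : A * √n ≤ A * √n / Δ * L := by
    rw [div_mul_eq_mul_div, le_div_iff₀ hΔ]
    exact mul_le_mul_of_nonneg_left hΔL (by positivity)
  refine le_of_mul_le_mul_right (h1.trans ?_) hLpos
  linarith [add_mul C (A * √n / Δ) L]

/-- The basic inequality of least squares. -/
theorem IsTameSample.sum_sq_le (h : IsTameSample n s ν z b c C d A κ B)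
    (ht : ∀ k : Fin (m + 1), t k.castSucc < t k.succ) (h0 : t 0 = 0)
    (htn : t (Fin.last (m + 1)) = n) (hopt : rss z δ t ≤ rss z ν s) {D : ℝ}
    (hD : ∀ k, |δ k| ≤ D) :
    ∑ k : Fin (m + 1), ∑ i ∈ Finset.Ioc (t k.castSucc) (t k.succ), (b i - δ k) ^ 2 ≤
      2 * (m + 1) * (A * √n) * (C + D) := by
  have hn := changePoint_le_of_segments ht htn
  have hsn : ∀ k : Fin (m + 1), s k.succ ≤ n := fun k => by
    rw [← h.last]
    exact (Fin.monotone_iff_le_succ.2 h.le) (Fin.le_last _)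
  have e1 : rss z ν s = ∑ i ∈ Finset.Ioc 0 n, (z i - b i) ^ 2 := by
    rw [← h.last, ← sum_segments h.le h.zero]
    refine Finset.sum_congr rfl fun k _ => Finset.sum_congr rfl fun i hi => ?_
    obtain ⟨hi1, hi2⟩ := Finset.mem_Ioc.1 hi
    rw [h.signal k i hi1 hi2]
  -- Expand (z - δ)² around the signal. Both cross terms pair the noise with a step function, so
  -- each is a combination of `m + 1` segment sums of the noise.
  have e2 : rss z δ t =
      ∑ k : Fin (m + 1), ∑ i ∈ Finset.Ioc (t k.castSucc) (t k.succ), (b i - δ k) ^ 2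
      + ∑ i ∈ Finset.Ioc 0 n, (z i - b i) ^ 2
      + 2 * ∑ i ∈ Finset.Ioc 0 n, (z i - b i) * b i
      - 2 * ∑ k : Fin (m + 1), δ k * ∑ i ∈ Finset.Ioc (t k.castSucc) (t k.succ), (z i - b i) := by
    rw [← htn, ← sum_segments (fun k => (ht k).le) h0, ← sum_segments (fun k => (ht k).le) h0,
      Finset.mul_sum, Finset.mul_sum, ← Finset.sum_add_distrib, ← Finset.sum_add_distrib,
      ← Finset.sum_sub_distrib]
    refine Finset.sum_congr rfl fun k _ => ?_
    rw [Finset.mul_sum, Finset.mul_sum, Finset.mul_sum, ← Finset.sum_add_distrib,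
      ← Finset.sum_add_distrib, ← Finset.sum_sub_distrib]
    exact Finset.sum_congr rfl fun i _ => by ring
  have e3 : ∑ i ∈ Finset.Ioc 0 n, (z i - b i) * b i =
      ∑ k : Fin (m + 1), ν k * ∑ i ∈ Finset.Ioc (s k.castSucc) (s k.succ), (z i - b i) := by
    rw [← h.last, ← sum_segments h.le h.zero]
    refine Finset.sum_congr rfl fun k _ => ?_
    rw [Finset.mul_sum]
    refine Finset.sum_congr rfl fun i hi => ?_
    obtain ⟨hi1, hi2⟩ := Finset.mem_Ioc.1 hi
    rw [h.signal k i hi1 hi2, mul_comm]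
  have b1 : |∑ k : Fin (m + 1), δ k *
      ∑ i ∈ Finset.Ioc (t k.castSucc) (t k.succ), (z i - b i)| ≤ (m + 1) * (D * (A * √n)) := by
    refine (Finset.abs_sum_le_sum_abs _ _).trans ?_
    have : ((m : ℝ) + 1) = ((Finset.univ : Finset (Fin (m + 1))).card : ℝ) := by simp
    rw [this, ← nsmul_eq_mul]
    refine Finset.sum_le_card_nsmul _ _ _ fun k _ => ?_
    rw [abs_mul]
    exact mul_le_mul (hD k) (h.noise _ _ (ht k).le (hn _)) (abs_nonneg _)
      ((abs_nonneg _).trans (hD k))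
  have b2 : |∑ k : Fin (m + 1), ν k *
      ∑ i ∈ Finset.Ioc (s k.castSucc) (s k.succ), (z i - b i)| ≤ (m + 1) * (C * (A * √n)) := by
    refine (Finset.abs_sum_le_sum_abs _ _).trans ?_
    have : ((m : ℝ) + 1) = ((Finset.univ : Finset (Fin (m + 1))).card : ℝ) := by simp
    rw [this, ← nsmul_eq_mul]
    refine Finset.sum_le_card_nsmul _ _ _ fun k _ => ?_
    rw [abs_mul]
    exact mul_le_mul (h.bound k) (h.noise _ _ (h.le k) (hsn _)) (abs_nonneg _)
      ((abs_nonneg _).trans (h.bound k))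
  have b1' := abs_le.1 b1
  have b2' := abs_le.1 b2
  rw [e1, e2, e3] at hopt
  linarith [b1'.2, b2'.1]

/-- If no estimated change-point is within `r` of a true one, the fit is bad. -/
theorem IsTameSample.le_sum_sq (h : IsTameSample n s ν z b c C d A κ B) (hd : 0 ≤ d) {r : ℕ}
    (hr : 0 < r) (hgap : ∀ k : Fin (m + 1), s k.castSucc + r ≤ s k.succ) (h0 : t 0 = 0)
    (htn : t (Fin.last (m + 1)) = n) (k : Fin m)
    (hsep : ∀ j, (r : ℝ) ≤ |(t j : ℝ) - s k.castSucc.succ|) :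
    r * d ^ 2 / 2 ≤
      ∑ k : Fin (m + 1), ∑ i ∈ Finset.Ioc (t k.castSucc) (t k.succ), (b i - δ k) ^ 2 := by
  have hg1 := hgap k.castSucc
  have hg2 := hgap k.succ
  rw [← Fin.succ_castSucc] at hg2
  have hsn : s k.castSucc.succ ≤ n := by
    rw [← h.last]
    exact (Fin.monotone_iff_le_succ.2 h.le) (Fin.le_last _)
  -- The estimated segment containing the change-point covers `r` indices on either side of it,
  -- where the signal takes two levels at least `d` apart. A single value `δ j` misses them by x and
  -- y with x² + y² ≥ d²/2.
  obtain ⟨j, hj1, hj2⟩ := exists_segment (t := t) (i := s k.castSucc.succ) (by omega) (by omega)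
  have hl : t j.castSucc + r ≤ s k.castSucc.succ := by
    have h1 := hsep j.castSucc
    have h2 : (t j.castSucc : ℝ) < s k.castSucc.succ := by exact_mod_cast hj1
    rw [abs_of_neg (by linarith)] at h1
    have : (t j.castSucc : ℝ) + r ≤ s k.castSucc.succ := by linarith
    exact_mod_cast this
  have hu : s k.castSucc.succ + r ≤ t j.succ := by
    have h1 := hsep j.succ
    have h2 : (s k.castSucc.succ : ℝ) ≤ t j.succ := by exact_mod_cast hj2
    rw [abs_of_nonneg (by linarith)] at h1
    have : (s k.castSucc.succ : ℝ) + r ≤ t j.succ := by linarith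
    exact_mod_cast this
  set S := s k.castSucc.succ with hS
  have e1 : ∑ i ∈ Finset.Ioc (S - r) S, (b i - δ j) ^ 2 = r * (ν k.castSucc - δ j) ^ 2 := by
    rw [Finset.sum_congr rfl (g := fun _ => (ν k.castSucc - δ j) ^ 2)]
    · rw [Finset.sum_const, Nat.card_Ioc, nsmul_eq_mul]
      congr 2
      omega
    · intro i hi
      obtain ⟨hi1, hi2⟩ := Finset.mem_Ioc.1 hi
      rw [h.signal k.castSucc i (by omega) hi2]
  have e2 : ∑ i ∈ Finset.Ioc S (S + r), (b i - δ j) ^ 2 = r * (ν k.succ - δ j) ^ 2 := by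
    rw [Finset.sum_congr rfl (g := fun _ => (ν k.succ - δ j) ^ 2)]
    · rw [Finset.sum_const, Nat.card_Ioc, nsmul_eq_mul]
      congr 2
      omega
    · intro i hi
      obtain ⟨hi1, hi2⟩ := Finset.mem_Ioc.1 hi
      rw [h.signal k.succ i (by rw [← Fin.succ_castSucc]; exact hi1) (by omega)]
  have e3 : d ^ 2 ≤ (ν k.castSucc - ν k.succ) ^ 2 := by
    rw [← sq_abs (ν k.castSucc - ν k.succ)]
    exact pow_le_pow_left₀ hd (h.jump k) 2
  calc (r : ℝ) * d ^ 2 / 2 ≤ r * (ν k.castSucc - δ j) ^ 2 + r * (ν k.succ - δ j) ^ 2 := by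
        have : d ^ 2 / 2 ≤ (ν k.castSucc - δ j) ^ 2 + (ν k.succ - δ j) ^ 2 := by
          nlinarith [sq_nonneg (ν k.castSucc - δ j + (ν k.succ - δ j))]
        have := mul_le_mul_of_nonneg_left this (Nat.cast_nonneg (α := ℝ) r)
        linarith
    _ = ∑ i ∈ Finset.Ioc (S - r) (S + r), (b i - δ j) ^ 2 := by
        rw [← e1, ← e2, Finset.sum_Ioc_consecutive _ (by omega) (by omega)]
    _ ≤ ∑ i ∈ Finset.Ioc (t j.castSucc) (t j.succ), (b i - δ j) ^ 2 :=
        Finset.sum_le_sum_of_subset_of_nonneg (Finset.Ioc_subset_Ioc (by omega) hu)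
          fun i _ _ => sq_nonneg _
    _ ≤ _ := Finset.single_le_sum
        (f := fun k : Fin (m + 1) => ∑ i ∈ Finset.Ioc (t k.castSucc) (t k.succ), (b i - δ k) ^ 2)
        (fun k _ => Finset.sum_nonneg fun i _ => sq_nonneg _) (Finset.mem_univ j)

/-- Bias arises only from indices of the estimated segment outside the true one, at most 2C each and
no more numerous than the two endpoint displacements. It serves twice: with displacements of order
γn to make levels accurate to d/8, then with bounded displacements for the final rate. -/
theorem IsTameSample.abs_fit_sub_le (h : IsTameSample n s ν z b c C d A κ B)
    (ht : ∀ k : Fin (m + 1), t k.castSucc < t k.succ) (htn : t (Fin.last (m + 1)) = n)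
    (hmean : ∀ k : Fin (m + 1), δ k * ((t k.succ : ℝ) - t k.castSucc) =
      ∑ i ∈ Finset.Ioc (t k.castSucc) (t k.succ), z i) (k : Fin (m + 1)) :
    |δ k - ν k| * ((t k.succ : ℝ) - t k.castSucc) ≤
      2 * C * (|(t k.castSucc : ℝ) - s k.castSucc| + |(t k.succ : ℝ) - s k.succ|) + A * √n := by
  have hn := changePoint_le_of_segments ht htn
  set I := Finset.Ioc (t k.castSucc) (t k.succ) with hI
  set J := Finset.Ioc (s k.castSucc) (s k.succ) with hJ
  have hC : 0 ≤ C := (abs_nonneg _).trans (h.bound k)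
  have hlen : (I.card : ℝ) = (t k.succ : ℝ) - t k.castSucc := by
    rw [hI, Nat.card_Ioc, Nat.cast_sub (ht k).le]
  have hsdiff : ((I \ J).card : ℝ) ≤
      |(t k.castSucc : ℝ) - s k.castSucc| + |(t k.succ : ℝ) - s k.succ| := by
    have hsub : I \ J ⊆ Finset.Ioc (t k.castSucc) (s k.castSucc) ∪
        Finset.Ioc (s k.succ) (t k.succ) := by
      intro i hi
      simp only [hI, hJ, Finset.mem_sdiff, Finset.mem_Ioc, Finset.mem_union] at hi ⊢
      omega
    have h1 := (Finset.card_le_card hsub).trans (Finset.card_union_le _ _)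
    rw [Nat.card_Ioc, Nat.card_Ioc] at h1
    have h2 : ∀ a b : ℕ, ((a - b : ℕ) : ℝ) ≤ |(a : ℝ) - b| := by
      intro a b
      rcases le_total b a with hab | hab
      · rw [Nat.cast_sub hab]
        exact le_abs_self _
      · rw [Nat.sub_eq_zero_of_le hab]
        simp
    have h3 := h2 (s k.castSucc) (t k.castSucc)
    rw [abs_sub_comm] at h3
    have h4 : ((I \ J).card : ℝ) ≤ ((s k.castSucc - t k.castSucc : ℕ) : ℝ) +
        ((t k.succ - s k.succ : ℕ) : ℝ) := by exact_mod_cast h1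
    linarith [h2 (t k.succ) (s k.succ)]
  have hb : |∑ i ∈ I, (b i - ν k)| ≤ (I \ J).card * (2 * C) := by
    have h1 : ∑ i ∈ I, (b i - ν k) = ∑ i ∈ I \ J, (b i - ν k) := by
      symm
      refine Finset.sum_subset Finset.sdiff_subset fun i hi hi' => ?_
      have hiJ : i ∈ J := by
        by_contra hc
        exact hi' (Finset.mem_sdiff.2 ⟨hi, hc⟩)
      obtain ⟨hi1, hi2⟩ := Finset.mem_Ioc.1 hiJ
      rw [h.signal k i hi1 hi2, sub_self]
    rw [h1, ← nsmul_eq_mul]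
    refine (Finset.abs_sum_le_sum_abs _ _).trans (Finset.sum_le_card_nsmul _ _ _ fun i hi => ?_)
    obtain ⟨hi1, hi2⟩ := Finset.mem_Ioc.1 (Finset.mem_sdiff.1 hi).1
    have h2 := h.abs_signal_le (i := i) (by omega) (hi2.trans (hn _))
    have h3 := h.bound k
    exact (abs_sub _ _).trans (by linarith)
  have hw := h.noise _ _ (ht k).le (hn k.succ)
  have hpos : (0 : ℝ) ≤ (t k.succ : ℝ) - t k.castSucc := by
    have : (t k.castSucc : ℝ) < t k.succ := by exact_mod_cast ht k
    linarith
  have heq : (δ k - ν k) * ((t k.succ : ℝ) - t k.castSucc) =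
      ∑ i ∈ I, (b i - ν k) + ∑ i ∈ I, (z i - b i) := by
    rw [sub_mul, hmean k, ← hlen, mul_comm, ← nsmul_eq_mul, ← Finset.sum_const,
      ← Finset.sum_sub_distrib, ← Finset.sum_add_distrib]
    exact Finset.sum_congr rfl fun i _ => by ring
  rw [← abs_of_nonneg hpos, ← abs_mul, heq]
  have h5 := mul_le_mul_of_nonneg_right hsdiff (show 0 ≤ 2 * C by linarith)
  calc _ ≤ _ := abs_add_le _ _
    _ ≤ (I \ J).card * (2 * C) + A * √n := add_le_add hb hw
    _ ≤ _ := by linarith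

/-- The cost of fitting the wrong value on an interval where the signal is constant. -/
theorem le_sum_sq_sub_sum_sq {p q : ℕ} (hpq : p ≤ q) {a a' α β : ℝ} (hd : 0 ≤ d)
    (hb : ∀ i, p < i → i ≤ q → b i = a) (ha : |a| ≤ C) (ha' : |a'| ≤ C) (haa : d ≤ |a - a'|)
    (hα : |α - a| ≤ d / 8) (hβ : |β - a'| ≤ d / 8) (hκ : 4 * (2 * C + d) * κ ≤ d ^ 2)
    (hw : |∑ i ∈ Finset.Ioc p q, (z i - b i)| ≤ κ * ((q : ℝ) - p) + B) :
    ((q : ℝ) - p) * d ^ 2 / 4 - 2 * (2 * C + d) * B ≤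
      ∑ i ∈ Finset.Ioc p q, (z i - β) ^ 2 - ∑ i ∈ Finset.Ioc p q, (z i - α) ^ 2 := by
  have hlen : ((Finset.Ioc p q).card : ℝ) = (q : ℝ) - p := by
    rw [Nat.card_Ioc, Nat.cast_sub hpq]
  have hC : 0 ≤ C := (abs_nonneg _).trans ha
  have hL : (0 : ℝ) ≤ (q : ℝ) - p := by
    rw [← hlen]
    positivity
  have heq : ∑ i ∈ Finset.Ioc p q, (z i - β) ^ 2 - ∑ i ∈ Finset.Ioc p q, (z i - α) ^ 2 =
      ((q : ℝ) - p) * ((a - β) ^ 2 - (a - α) ^ 2) +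
        2 * (α - β) * ∑ i ∈ Finset.Ioc p q, (z i - b i) := by
    rw [← hlen, ← nsmul_eq_mul, ← Finset.sum_const, Finset.mul_sum, ← Finset.sum_sub_distrib,
      ← Finset.sum_add_distrib]
    refine Finset.sum_congr rfl fun i hi => ?_
    obtain ⟨hi1, hi2⟩ := Finset.mem_Ioc.1 hi
    rw [hb i hi1 hi2]
    ring
  have h1 : 7 * d / 8 ≤ |a - β| := by
    have : |a - a'| ≤ |a - β| + |β - a'| := abs_sub_le _ _ _
    linarith
  have h2 : (7 * d / 8) ^ 2 ≤ (a - β) ^ 2 := by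
    rw [← sq_abs (a - β)]
    exact pow_le_pow_left₀ (by positivity) h1 2
  have h3 : (a - α) ^ 2 ≤ (d / 8) ^ 2 := by
    rw [← sq_abs (a - α), abs_sub_comm]
    exact pow_le_pow_left₀ (abs_nonneg _) hα 2
  -- (7/8)² - (1/8)² = 3/4. The noise takes back at most 2(2C + d)κ ≤ d²/2 per index, which leaves
  -- d²/4.
  have h4 : 3 * d ^ 2 / 4 ≤ (a - β) ^ 2 - (a - α) ^ 2 := by nlinarith
  have h5 : |α - β| ≤ 2 * C + d := by
    have e1 : |α - β| ≤ |α - a| + |a - β| := abs_sub_le _ _ _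
    have e2 : |a - β| ≤ |a - a'| + |a' - β| := abs_sub_le _ _ _
    have e3 : |a - a'| ≤ |a| + |a'| := abs_sub _ _
    rw [abs_sub_comm a' β] at e2
    linarith
  have h6 : |2 * (α - β) * ∑ i ∈ Finset.Ioc p q, (z i - b i)| ≤
      2 * (2 * C + d) * (κ * ((q : ℝ) - p) + B) := by
    rw [abs_mul, abs_mul, abs_two]
    refine mul_le_mul (by linarith) hw (abs_nonneg _) (by linarith)
  have h7 := (abs_le.1 h6).1
  have h8 := mul_le_mul_of_nonneg_left h4 hL
  have h9 := mul_le_mul_of_nonneg_right hκ hL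
  rw [heq]
  nlinarith

/-- The competitor keeps the fitted levels and uses the true change-points. Summation by parts
splits the difference of costs into one term per inner change-point, each bounded below by
`le_sum_sq_sub_sum_sq`; as the total is nonpositive, no single term can exceed the `m` constants
2(2C + d)B. The hypotheses `hlo` and `hhi` keep the signal constant between an estimate and its
target. -/
theorem IsTameSample.abs_changePoint_sub_le (h : IsTameSample n s ν z b c C d A κ B) (hd : 0 < d)
    (hB : 0 ≤ B) (hκ : 4 * (2 * C + d) * κ ≤ d ^ 2)
    (ht : ∀ k : Fin (m + 1), t k.castSucc < t k.succ) (h0 : t 0 = 0)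
    (htn : t (Fin.last (m + 1)) = n) (hopt : rss z δ t ≤ rss z δ s)
    (hlo : ∀ k : Fin m, s k.castSucc.castSucc ≤ t k.castSucc.succ)
    (hhi : ∀ k : Fin m, t k.castSucc.succ ≤ s k.succ.succ)
    (hδ : ∀ k, |δ k - ν k| ≤ d / 8) (k : Fin (m + 2)) :
    |(t k : ℝ) - s k| ≤ 8 * m * (2 * C + d) * B / d ^ 2 := by
  have hC : 0 ≤ C := (abs_nonneg _).trans (h.bound 0)
  have hn := changePoint_le_of_segments ht htn
  have hpart : ∀ k : Fin m,
      |(t k.castSucc.succ : ℝ) - s k.castSucc.succ| * d ^ 2 / 4 - 2 * (2 * C + d) * B ≤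
      (∑ i ∈ Finset.Ioc 0 (t k.castSucc.succ), (z i - δ k.castSucc) ^ 2
        - ∑ i ∈ Finset.Ioc 0 (t k.castSucc.succ), (z i - δ k.succ) ^ 2)
      - (∑ i ∈ Finset.Ioc 0 (s k.castSucc.succ), (z i - δ k.castSucc) ^ 2
        - ∑ i ∈ Finset.Ioc 0 (s k.castSucc.succ), (z i - δ k.succ) ^ 2) := by
    intro k
    rcases le_total (t k.castSucc.succ) (s k.castSucc.succ) with hts | hts
    · have hts' : (t k.castSucc.succ : ℝ) ≤ s k.castSucc.succ := by exact_mod_cast hts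
      have := le_sum_sq_sub_sum_sq (z := z) (b := b) hts hd.le
        (fun i hi1 hi2 => h.signal k.castSucc i ((hlo k).trans_lt hi1) hi2) (h.bound _)
        (h.bound k.succ) (h.jump k) (hδ k.castSucc) (hδ k.succ) hκ (h.noise_left k _ hts)
      rw [sum_Ioc_eq_sub hts, sum_Ioc_eq_sub hts] at this
      rw [abs_of_nonpos (by linarith)]
      linarith
    · have hts' : (s k.castSucc.succ : ℝ) ≤ t k.castSucc.succ := by exact_mod_cast hts
      have hj := h.jump k
      rw [abs_sub_comm] at hj
      have := le_sum_sq_sub_sum_sq (z := z) (b := b) hts hd.le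
        (fun i hi1 hi2 => h.signal k.succ i (by rwa [← Fin.succ_castSucc])
          (hi2.trans (hhi k))) (h.bound _)
        (h.bound k.castSucc) hj (hδ k.succ) (hδ k.castSucc) hκ (h.noise_right k _ hts (hn _))
      rw [sum_Ioc_eq_sub hts, sum_Ioc_eq_sub hts] at this
      rw [abs_of_nonneg (by linarith)]
      linarith
  have hsum : ∑ k : Fin m, (|(t k.castSucc.succ : ℝ) - s k.castSucc.succ| * d ^ 2 / 4
      - 2 * (2 * C + d) * B) ≤ 0 := by
    refine (Finset.sum_le_sum fun k _ => hpart k).trans ?_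
    rw [Finset.sum_sub_distrib]
    have e1 := sum_sum_segments (fun k => (ht k).le) fun k i => (z i - δ k) ^ 2
    have e2 := sum_sum_segments h.le fun k i => (z i - δ k) ^ 2
    rw [h0, htn] at e1
    rw [h.zero, h.last] at e2
    unfold rss at hopt
    rw [e1, e2] at hopt
    linarith
  rw [Finset.sum_sub_distrib, Finset.sum_const, Finset.card_univ, Fintype.card_fin,
    nsmul_eq_mul] at hsum
  have hnn : 0 ≤ 8 * m * (2 * C + d) * B / d ^ 2 := by positivity
  refine Fin.cases ?_ (fun k => ?_) k
  · rw [h0, h.zero]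
    simpa using hnn
  · refine Fin.lastCases ?_ (fun k => ?_) k
    · rw [Fin.succ_last, htn, h.last]
      simpa using hnn
    · rw [le_div_iff₀ (by positivity)]
      have := Finset.single_le_sum
        (f := fun k : Fin m => |(t k.castSucc.succ : ℝ) - s k.castSucc.succ| * d ^ 2 / 4)
        (fun k _ => by positivity) (Finset.mem_univ k)
      linarith

end Segments

/-! ### From consistency to rates for tame samples. -/

theorem eventually_sqrt_inv_bounds {Δ : ℕ → ℝ} (hΔ : Tendsto Δ atTop atTop) {e : ℝ} (he : 0 < e)
    (a b : ℝ) : ∀ᶠ n : ℕ in atTop, a * (1 / √(n : ℝ)) + b * (1 / Δ n) < e := by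
  have h1 : Tendsto (fun n : ℕ => 1 / √(n : ℝ)) atTop (𝓝 0) := by
    simp_rw [one_div]
    exact (Real.tendsto_sqrt_atTop.comp tendsto_natCast_atTop_atTop).inv_tendsto_atTop
  have h2 : Tendsto (fun n : ℕ => 1 / Δ n) atTop (𝓝 0) := by
    simp_rw [one_div]
    exact hΔ.inv_tendsto_atTop
  have h3 := (h1.const_mul a).add (h2.const_mul b)
  simp only [mul_zero, add_zero] at h3
  exact h3.eventually_lt_const he

set_option maxHeartbeats 1000000 in
/-- Deterministic rates of convergence of the least-squares fit of a tame sample. -/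
theorem eventually_forall_isTameSample_rate (m : ℕ) {Δ : ℕ → ℝ} (hΔ : Tendsto Δ atTop atTop)
    {c C d A κ B : ℝ} (hc : 0 < c) (hC : 0 ≤ C) (hd : 0 < d) (hA : 0 ≤ A) (hB : 0 ≤ B)
    (hκ : 4 * (2 * C + d) * κ ≤ d ^ 2) :
    ∃ K : ℝ, 0 ≤ K ∧ ∀ᶠ n : ℕ in atTop, ∀ (s : Fin (m + 2) → ℕ) (ν : Fin (m + 1) → ℝ)
      (z b : ℕ → ℝ) (δ : Fin (m + 1) → ℝ) (t : Fin (m + 2) → ℕ),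
      IsTameSample n s ν z b c C d A κ B → s ∈ admissible m n (Δ n) → t ∈ admissible m n (Δ n) →
      (∀ δ', ∀ t' ∈ admissible m n (Δ n), rss z δ t ≤ rss z δ' t') →
      (∀ k, |(t k : ℝ) - s k| ≤ K) ∧ ∀ k, |δ k - ν k| ≤ K * (1 / √n) := by
  -- The first bound makes true change-points at least `4 * r` apart, where `r` is the floor of γn;
  -- the second makes the bias 4Cr at most (d/16)(cn/2).
  set γ : ℝ := min (c / 4) (c * d / (128 * (C + 1))) with hγ
  have hγ0 : 0 < γ := by positivity
  have hγ1 : γ ≤ c / 4 := min_le_left _ _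
  have hγ2 : 128 * γ * C ≤ c * d := by
    have h1 : γ ≤ c * d / (128 * (C + 1)) := min_le_right _ _
    rw [le_div_iff₀ (by positivity)] at h1
    nlinarith
  set K1 : ℝ := 8 * m * (2 * C + d) * B / d ^ 2 with hK1
  have hK10 : 0 ≤ K1 := by positivity
  set K2 : ℝ := (4 * C * K1 + A) * 2 / c with hK2
  have hK20 : 0 ≤ K2 := by positivity
  refine ⟨K1 + K2, by positivity, ?_⟩
  -- The threshold γd²/4, times n, is at most rd²/2 because r ≥ γn/2: the basic inequality then
  -- contradicts the cost of a missed change-point.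
  have hev1 := eventually_sqrt_inv_bounds hΔ (e := γ * d ^ 2 / 4) (by positivity)
    (2 * (m + 1) * A * (2 * C)) (2 * (m + 1) * A * A)
  have hev2 := eventually_sqrt_inv_bounds hΔ (e := d / 16) (by positivity) (2 * A / c) 0
  have hev3 : ∀ᶠ n : ℕ in atTop, 2 / γ ≤ (n : ℝ) :=
    tendsto_natCast_atTop_atTop.eventually_ge_atTop _
  filter_upwards [hev1, hev2, hev3, hΔ.eventually_gt_atTop 0, eventually_ge_atTop 1]
    with n hn1 hn2 hn3 hΔn hn
  intro s ν z b δ t h hs ht hopt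
  have hnR : (1 : ℝ) ≤ n := by exact_mod_cast hn
  have hsq : √(n : ℝ) * √n = n := Real.mul_self_sqrt (by positivity)
  have hsq1 : 1 ≤ √(n : ℝ) := Real.one_le_sqrt.2 hnR
  have hγn : 2 ≤ γ * n := by rwa [div_le_iff₀ hγ0, mul_comm] at hn3
  have htseg : ∀ k : Fin (m + 1), t k.castSucc < t k.succ := fun k => (ht.2.2 k).1
  have htmono : StrictMono t := Fin.strictMono_iff_lt_succ.2 htseg
  have hmean := mul_card_eq_sum_of_forall_rss_le htseg fun δ' => hopt δ' t ht
  set r : ℕ := ⌊γ * n⌋₊ with hr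
  have hrle : (r : ℝ) ≤ γ * n := Nat.floor_le (by positivity)
  have hrge : γ * n / 2 ≤ r := by
    have := Nat.lt_floor_add_one (γ * (n : ℝ))
    rw [← hr] at this
    linarith
  have hr0 : 0 < r := by
    have : (0 : ℝ) < r := by linarith
    exact_mod_cast this
  have hγc : γ * n ≤ c * n / 4 := by nlinarith
  have hgapR : ∀ k : Fin (m + 1), (s k.castSucc : ℝ) + 4 * r ≤ s k.succ := by
    intro k
    have := h.gap k
    linarith
  have hgap : ∀ k : Fin (m + 1), s k.castSucc + r ≤ s k.succ := by
    intro k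
    have : (s k.castSucc : ℝ) + r ≤ s k.succ := by
      have : (0 : ℝ) ≤ r := Nat.cast_nonneg r
      linarith [hgapR k]
    exact_mod_cast this
  have hgapAll : ∀ k l : Fin (m + 2), k < l → (s k : ℝ) + 2 * r ≤ s l := by
    have hsm : Monotone s := Fin.monotone_iff_le_succ.2 h.le
    intro k l hkl
    obtain ⟨k, rfl⟩ := Fin.exists_castSucc_eq.2 (ne_of_lt (hkl.trans_le (Fin.le_last l)))
    have h1 : (s k.succ : ℝ) ≤ s l := by
      exact_mod_cast hsm (Fin.castSucc_lt_iff_succ_le.1 hkl)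
    have : (0 : ℝ) ≤ r := Nat.cast_nonneg r
    linarith [hgapR k]
  have hfit := h.sum_sq_le htseg ht.1 ht.2.1 (hopt ν s hs) (h.abs_fit_le hΔn hA ht hmean)
  have hclose : ∀ k, ∃ j, |(t j : ℝ) - s k| < r := by
    intro k
    by_contra! hsep
    have hrR : (0 : ℝ) < r := by exact_mod_cast hr0
    induction k using Fin.cases with
    | zero =>
      have := hsep 0
      rw [ht.1, h.zero, sub_self, abs_zero] at this
      linarith
    | succ k =>
      induction k using Fin.lastCases with
      | last =>
        have := hsep (Fin.last (m + 1))
        rw [Fin.succ_last, ht.2.1, h.last, sub_self, abs_zero] at this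
        linarith
      | cast k =>
        have hbad := h.le_sum_sq (δ := δ) hd.le hr0 hgap ht.1 ht.2.1 k hsep
        have h1 := hbad.trans hfit
        have h2 : 2 * (m + 1) * (A * √n) * (C + (C + A * √n / Δ n)) =
            (2 * (m + 1) * A * (2 * C) * (1 / √n) + 2 * (m + 1) * A * A * (1 / Δ n)) * n := by
          have hq : √(n : ℝ) ≠ 0 := by positivity
          have hsq' : (n : ℝ) = √n * √n := hsq.symm
          generalize √(n : ℝ) = q at hq hsq'
          rw [hsq']
          field_simp
          ring
        rw [h2] at h1
        have h3 := mul_lt_mul_of_pos_right hn1 (show (0 : ℝ) < n by linarith)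
        have h4 := mul_le_mul_of_nonneg_right hrge (show 0 ≤ d ^ 2 / 2 by positivity)
        linarith
  have hr' := abs_sub_lt_of_forall_exists (s := fun k => (s k : ℝ)) (t := fun k => (t k : ℝ))
    (Nat.strictMono_cast.comp htmono) hgapAll hclose
  have hlen : ∀ k : Fin (m + 1), c * n / 2 ≤ (t k.succ : ℝ) - t k.castSucc := by
    intro k
    have h1 := abs_lt.1 (hr' k.succ)
    have h2 := abs_lt.1 (hr' k.castSucc)
    linarith [h.gap k]
  have hfitR : ∀ x : ℝ, (∀ k, |(t k : ℝ) - s k| ≤ x) → ∀ k,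
      |δ k - ν k| ≤ (4 * C * x + A * √n) / (c * n / 2) := by
    intro x hx k
    rw [le_div_iff₀ (by positivity)]
    have h1 := h.abs_fit_sub_le htseg ht.2.1 hmean k
    have h2 := mul_le_mul_of_nonneg_left (hlen k) (abs_nonneg (δ k - ν k))
    have h3 := mul_le_mul_of_nonneg_left (add_le_add (hx k.castSucc) (hx k.succ))
      (show 0 ≤ 2 * C by positivity)
    linarith
  have hδ : ∀ k, |δ k - ν k| ≤ d / 8 := by
    intro k
    refine (hfitR r (fun k => (hr' k).le) k).trans ?_
    rw [div_le_iff₀ (by positivity)]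
    have h1 : 4 * C * r ≤ d / 16 * (c * n / 2) := by nlinarith
    have h2 : A * √n ≤ d / 16 * (c * n / 2) := by
      have h3 : 2 * A / c * (1 / √n) ≤ d / 16 := by linarith
      rw [div_mul_div_comm, mul_one, div_le_iff₀ (by positivity)] at h3
      nlinarith
    linarith
  have hK : ∀ k, |(t k : ℝ) - s k| ≤ K1 := by
    refine h.abs_changePoint_sub_le hd hB hκ htseg ht.1 ht.2.1 (hopt δ s hs) ?_ ?_ hδ
    · intro k
      have h1 := abs_lt.1 (hr' k.castSucc.succ)
      have : (s k.castSucc.castSucc : ℝ) ≤ t k.castSucc.succ := by linarith [hgapR k.castSucc]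
      exact_mod_cast this
    · intro k
      have h1 := abs_lt.1 (hr' k.castSucc.succ)
      have h2 := hgapR k.succ
      rw [← Fin.succ_castSucc] at h2
      have : (t k.castSucc.succ : ℝ) ≤ s k.succ.succ := by linarith
      exact_mod_cast this
  refine ⟨fun k => (hK k).trans (by linarith), fun k => (hfitR K1 hK k).trans ?_⟩
  have h1 : 4 * C * K1 + A * √n ≤ (4 * C * K1 + A) * √n := by
    have : 0 ≤ 4 * C * K1 := by positivity
    nlinarith
  calc (4 * C * K1 + A * √n) / (c * n / 2) ≤ (4 * C * K1 + A) * √n / (c * n / 2) := by gcongr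
    _ = K2 * (1 / √n) := by
      have hq : √(n : ℝ) ≠ 0 := by positivity
      have hsq' : (n : ℝ) = √n * √n := hsq.symm
      rw [hK2]
      clear_value K1
      generalize √(n : ℝ) = q at hq hsq'
      rw [hsq']
      field_simp
    _ ≤ (K1 + K2) * (1 / √n) := by
      gcongr
      linarith

/-! ### Pathwise reduction of the decorrelated series to the innovations. -/

section Path

variable {ρ : ℝ} {e x : ℕ → ℝ}

theorem abs_ar_path_le (hρ : |ρ| < 1) (hrec : ∀ i, x (i + 1) = ρ * x i + e (i + 1)) {n : ℕ}
    {a : ℝ} (ha0 : 0 ≤ a) (ha : ∀ j, j < n → |e (j + 1)| ≤ a) {j : ℕ} (hj : j ≤ n) :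
    |x j| ≤ |x 0| + a / (1 - |ρ|) := by
  have h1 : 0 < 1 - |ρ| := by linarith
  induction j with
  | zero =>
    have : 0 ≤ a / (1 - |ρ|) := by positivity
    linarith
  | succ j ih =>
    have ih := ih (by omega)
    have ha' := ha j (by omega)
    rw [hrec]
    have h2 : |ρ * x j + e (j + 1)| ≤ |ρ| * |x j| + |e (j + 1)| := by
      rw [← abs_mul]
      exact abs_add_le _ _
    have h3 := mul_le_mul_of_nonneg_left ih (abs_nonneg ρ)
    have h4 : |ρ| * (|x 0| + a / (1 - |ρ|)) + a = |ρ| * |x 0| + a / (1 - |ρ|) := by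
      field_simp
      ring
    have h5 : |ρ| * |x 0| ≤ |x 0| := mul_le_of_le_one_left (abs_nonneg _) hρ.le
    linarith

/-- Summing the recursion telescopes, so sums of the AR path inherit the √n bound of the innovation
sums up to two end values. -/
theorem sum_ar_path_mul (hrec : ∀ i, x (i + 1) = ρ * x i + e (i + 1)) {p q : ℕ} (hpq : p ≤ q) :
    (1 - ρ) * ∑ i ∈ Finset.Ioc p q, x (i - 1) = ∑ i ∈ Finset.Ioc p q, e i - (x q - x p) := by
  induction q, hpq using Nat.le_induction with
  | base => simp
  | succ q hq ih =>
    rw [Finset.sum_Ioc_succ_top hq, Finset.sum_Ioc_succ_top hq, mul_add, ih, hrec,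
      Nat.add_sub_cancel]
    ring

/-- Partial sums of a decorrelated series, centred by its limiting mean. -/
theorem sum_decorrelated_eq (hrec : ∀ i, x (i + 1) = ρ * x i + e (i + 1)) (y : ℕ → ℝ) (ρ' : ℝ)
    {p q : ℕ} (hpq : p ≤ q) :
    ∑ i ∈ Finset.Ioc p q, ((y i - ρ' * y (i - 1)) - (1 - ρ') * (y i - x i)) =
      ∑ i ∈ Finset.Ioc p q, e i + (ρ - ρ') * ∑ i ∈ Finset.Ioc p q, x (i - 1)
        + ρ' * ((y q - x q) - (y p - x p)) := by
  -- With M = y - x, each summand is e_i + (ρ - ρ')x_{i-1} + ρ'(M_i - M_{i-1}), and the last part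
  -- telescopes.
  induction q, hpq using Nat.le_induction with
  | base => simp
  | succ q hq ih =>
    rw [Finset.sum_Ioc_succ_top hq, Finset.sum_Ioc_succ_top hq, Finset.sum_Ioc_succ_top hq, ih,
      hrec, Nat.add_sub_cancel]
    ring

/-- The noise sums differ from the innovation sums by at most a constant, added to A√n and to the
intercept `B` alike. The factors 3 and (1 - |ρ|)/2 bound |1 - ρ'| above and below once ρ' is close
to ρ. -/
theorem isTameSample_of_path {m n : ℕ} {s : Fin (m + 2) → ℕ} {μ : Fin (m + 1) → ℝ} {y : ℕ → ℝ}
    {ρ' c Cμ dμ A₀ A₁ A₂ κ B : ℝ} (hn : 1 ≤ n) (hρ : |ρ| < 1)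
    (hrec : ∀ i, x (i + 1) = ρ * x i + e (i + 1))
    (hs0 : s 0 = 0) (hsn : s (Fin.last (m + 1)) = n)
    (hs : ∀ k : Fin (m + 1), s k.castSucc ≤ s k.succ)
    (hgap : ∀ k : Fin (m + 1), c * n ≤ (s k.succ : ℝ) - s k.castSucc)
    (hy0 : y 0 = μ 0 + x 0)
    (hy : ∀ (k : Fin (m + 1)) (i : ℕ), s k.castSucc < i → i ≤ s k.succ → y i = μ k + x i)
    (hCμ : ∀ k, |μ k| ≤ Cμ) (hdμ0 : 0 ≤ dμ)
    (hdμ : ∀ k : Fin m, dμ ≤ |μ k.castSucc - μ k.succ|)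
    (hS : ∀ j, j ≤ n → |∑ i ∈ Finset.Ioc 0 j, e i| ≤ A₀ * √n) (hx0 : |x 0| ≤ A₂)
    (hρ' : |ρ' - ρ| ≤ A₁ * (1 / √n)) (hρ'' : A₁ * (1 / √n) ≤ (1 - |ρ|) / 2)
    (hleft : ∀ (k : Fin m) (p : ℕ), p ≤ s k.castSucc.succ →
      |∑ i ∈ Finset.Ioc p (s k.castSucc.succ), e i| ≤ κ * ((s k.castSucc.succ : ℝ) - p) + B)
    (hright : ∀ (k : Fin m) (q : ℕ), s k.castSucc.succ ≤ q →
      |∑ i ∈ Finset.Ioc (s k.castSucc.succ) q, e i| ≤ κ * ((q : ℝ) - s k.castSucc.succ) + B) :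
    IsTameSample n s (fun k => (1 - ρ') * μ k) (fun i => y i - ρ' * y (i - 1))
      (fun i => (1 - ρ') * (y i - x i)) c (3 * Cμ) (dμ * (1 - |ρ|) / 2)
      (2 * A₀ + (A₁ * ((2 * A₀ + 2 * (A₂ + 2 * A₀ / (1 - |ρ|))) / (1 - |ρ|)) + 4 * Cμ)) κ
      (B + (A₁ * ((2 * A₀ + 2 * (A₂ + 2 * A₀ / (1 - |ρ|))) / (1 - |ρ|)) + 4 * Cμ)) := by
  set R : ℝ := A₁ * ((2 * A₀ + 2 * (A₂ + 2 * A₀ / (1 - |ρ|))) / (1 - |ρ|)) + 4 * Cμ with hR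
  have h1 : 0 < 1 - |ρ| := by linarith
  have hsq1 : 1 ≤ √(n : ℝ) := Real.one_le_sqrt.2 (by exact_mod_cast hn)
  have hsq0 : 0 < √(n : ℝ) := by linarith
  have hA₀ : 0 ≤ A₀ := by
    have := (abs_nonneg _).trans (hS 0 (Nat.zero_le n))
    exact nonneg_of_mul_nonneg_left this hsq0
  have hA₁ : 0 ≤ A₁ := by
    have := (abs_nonneg _).trans hρ'
    exact nonneg_of_mul_nonneg_left this (by positivity)
  have hA₂ : 0 ≤ A₂ := (abs_nonneg _).trans hx0
  have hC0 : 0 ≤ Cμ := (abs_nonneg _).trans (hCμ 0)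
  have hρabs := abs_le.1 (hρ'.trans hρ'')
  have hρlo := neg_abs_le ρ
  have hρhi := le_abs_self ρ
  have hρ'2 : |ρ'| ≤ 2 := abs_le.2 ⟨by linarith, by linarith⟩
  have hρ'lo : (1 - |ρ|) / 2 ≤ |1 - ρ'| := (by linarith : (1 - |ρ|) / 2 ≤ 1 - ρ').trans
    (le_abs_self _)
  have hρ'hi : |1 - ρ'| ≤ 3 := abs_le.2 ⟨by linarith, by linarith⟩
  have hM : ∀ i, i ≤ n → |y i - x i| ≤ Cμ := by
    intro i hi
    rcases Nat.eq_zero_or_pos i with rfl | hi0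
    · rw [hy0, add_sub_cancel_right]
      exact hCμ 0
    · obtain ⟨k, hk1, hk2⟩ := exists_segment (t := s) (by rwa [hs0]) (by rwa [hsn])
      rw [hy k i hk1 hk2, add_sub_cancel_right]
      exact hCμ k
  have hSpq : ∀ p q, p ≤ q → q ≤ n → |∑ i ∈ Finset.Ioc p q, e i| ≤ 2 * A₀ * √n := by
    intro p q hpq hqn
    rw [sum_Ioc_eq_sub hpq]
    have := abs_sub (∑ i ∈ Finset.Ioc 0 q, e i) (∑ i ∈ Finset.Ioc 0 p, e i)
    linarith [hS q hqn, hS p (hpq.trans hqn)]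
  have hxb : ∀ j, j ≤ n → |x j| ≤ (A₂ + 2 * A₀ / (1 - |ρ|)) * √n := by
    intro j hj
    -- A single innovation is a partial sum over a one-point interval, hence also O(√n).
    have h2 := abs_ar_path_le hρ hrec (a := 2 * A₀ * √n) (by positivity)
      (fun i hi => by
        have := hSpq i (i + 1) (Nat.le_succ i) hi
        rwa [Nat.Ioc_succ_singleton, Finset.sum_singleton] at this) hj
    have h3 : A₂ ≤ A₂ * √n := le_mul_of_one_le_right hA₂ hsq1
    have h4 : 2 * A₀ * √n / (1 - |ρ|) = 2 * A₀ / (1 - |ρ|) * √n := by ring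
    rw [h4] at h2
    linarith
  have hH : ∀ p q, p ≤ q → q ≤ n → |∑ i ∈ Finset.Ioc p q, x (i - 1)| ≤
      (2 * A₀ + 2 * (A₂ + 2 * A₀ / (1 - |ρ|))) / (1 - |ρ|) * √n := by
    intro p q hpq hqn
    have h2 := sum_ar_path_mul hrec hpq
    have h3 : (1 - |ρ|) * |∑ i ∈ Finset.Ioc p q, x (i - 1)| ≤
        |(1 - ρ) * ∑ i ∈ Finset.Ioc p q, x (i - 1)| := by
      rw [abs_mul]
      exact mul_le_mul_of_nonneg_right
        ((by linarith : 1 - |ρ| ≤ 1 - ρ).trans (le_abs_self _)) (abs_nonneg _)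
    rw [h2] at h3
    have h4 := abs_sub (∑ i ∈ Finset.Ioc p q, e i) (x q - x p)
    have h5 := abs_sub (x q) (x p)
    have h6 := hxb q hqn
    have h7 := hxb p (hpq.trans hqn)
    have h8 := hSpq p q hpq hqn
    rw [div_mul_eq_mul_div, le_div_iff₀ h1]
    linarith
  have hW : ∀ p q, p ≤ q → q ≤ n →
      |∑ i ∈ Finset.Ioc p q, ((y i - ρ' * y (i - 1)) - (1 - ρ') * (y i - x i))| ≤
        |∑ i ∈ Finset.Ioc p q, e i| + R := by
    intro p q hpq hqn
    rw [sum_decorrelated_eq hrec y ρ' hpq]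
    have h2 : |(ρ - ρ') * ∑ i ∈ Finset.Ioc p q, x (i - 1)| ≤
        A₁ * ((2 * A₀ + 2 * (A₂ + 2 * A₀ / (1 - |ρ|))) / (1 - |ρ|)) := by
      rw [abs_mul, abs_sub_comm]
      refine (mul_le_mul hρ' (hH p q hpq hqn) (abs_nonneg _) (by positivity)).trans (le_of_eq ?_)
      field_simp
    have h3 : |ρ' * ((y q - x q) - (y p - x p))| ≤ 4 * Cμ := by
      rw [abs_mul]
      have h4 := abs_sub (y q - x q) (y p - x p)
      have h5 := hM q hqn
      have h6 := hM p (hpq.trans hqn)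
      calc _ ≤ 2 * (2 * Cμ) := mul_le_mul hρ'2 (by linarith) (abs_nonneg _) (by norm_num)
        _ = 4 * Cμ := by ring
    have h4 := abs_add_le (∑ i ∈ Finset.Ioc p q, e i + (ρ - ρ') * ∑ i ∈ Finset.Ioc p q, x (i - 1))
      (ρ' * ((y q - x q) - (y p - x p)))
    have h5 := abs_add_le (∑ i ∈ Finset.Ioc p q, e i) ((ρ - ρ') * ∑ i ∈ Finset.Ioc p q, x (i - 1))
    linarith
  have hR0 : 0 ≤ R := by positivity
  have hsle : ∀ k, s k ≤ n := fun k => by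
    rw [← hsn]
    exact (Fin.monotone_iff_le_succ.2 hs) (Fin.le_last _)
  refine ⟨hs0, hsn, hs, hgap, ?_, ?_, ?_, ?_, ?_, ?_⟩
  · intro k i h2 h3
    simp only [hy k i h2 h3, add_sub_cancel_right]
  · intro k
    rw [abs_mul]
    exact mul_le_mul hρ'hi (hCμ k) (abs_nonneg _) (by norm_num)
  · intro k
    rw [← mul_sub, abs_mul]
    have := mul_le_mul hρ'lo (hdμ k) hdμ0 (abs_nonneg _)
    linarith
  · intro p q hpq hqn
    have h2 := hW p q hpq hqn
    have h3 := hSpq p q hpq hqn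
    have h4 : R ≤ R * √n := le_mul_of_one_le_right hR0 hsq1
    rw [add_mul]
    linarith
  · intro k p hp
    have h2 := hW p _ hp (hsle _)
    have h3 := hleft k p hp
    linarith
  · intro k q hq hqn
    have h2 := hW _ q hq hqn
    have h3 := hright k q hq
    linarith

end Path

/-! ### Maximal inequalities for the i.i.d. innovations. -/

section Noise

variable {Ω : Type*} [MeasurableSpace Ω] {P : Measure Ω} {ε : ℤ → Ω → ℝ}

theorem IsIIDNoise.integral_sq (hε : IsIIDNoise P ε) (i : ℤ) :
    ∫ ω, ε i ω ^ 2 ∂P = ∫ ω, ε 0 ω ^ 2 ∂P :=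
  ((hε.identDistrib i).comp (u := fun x : ℝ => x ^ 2) (by fun_prop)).integral_eq

theorem IsIIDNoise.integral_eq_zero (hε : IsIIDNoise P ε) (i : ℤ) : ∫ ω, ε i ω ∂P = 0 :=
  (hε.identDistrib i).integral_eq.trans hε.mean_zero

theorem IsIIDNoise.memLp_two (hε : IsIIDNoise P ε) (i : ℤ) : MemLp (ε i) 2 P :=
  (hε.identDistrib i).memLp_iff.2 hε.memLp

theorem sum_Ioc_eq_sum_range_add (f : ℤ → ℝ) (p l : ℕ) :
    ∑ i ∈ Finset.Ioc p (p + l), f i = ∑ j ∈ Finset.range l, f (p + 1 + j) := by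
  induction l with
  | zero => simp
  | succ l ih =>
    rw [← add_assoc, Finset.sum_Ioc_succ_top (by omega), ih, Finset.sum_range_succ]
    congr 2
    push_cast
    ring

theorem sum_Ioc_eq_sum_range_sub (f : ℤ → ℝ) {p l : ℕ} (h : l ≤ p) :
    ∑ i ∈ Finset.Ioc (p - l) p, f i = ∑ j ∈ Finset.range l, f (p - j) := by
  induction l with
  | zero => simp
  | succ l ih =>
    rw [← Finset.sum_Ioc_consecutive _ (show p - (l + 1) ≤ p - l by omega) (by omega), ih (by omega),
      Finset.sum_range_succ, add_comm]
    congr 1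
    obtain ⟨q, hq⟩ : ∃ q, p - l = q + 1 := ⟨p - l - 1, by omega⟩
    have hq' : p - (l + 1) = q := by omega
    rw [hq, hq', Nat.Ioc_succ_singleton, Finset.sum_singleton]
    congr 1
    omega

theorem IsIIDNoise.measure_exists_le_abs_sum_le [IsProbabilityMeasure P]
    (hε : IsIIDNoise P ε) {a : ℝ} (ha : 0 < a)
    (n : ℕ) :
    P {ω | ∃ j ≤ n, a ≤ |∑ i ∈ Finset.Ioc 0 j, ε i ω|} ≤
      ENNReal.ofReal (n * (∫ ω, ε 0 ω ^ 2 ∂P) / a ^ 2) := by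
  have hinj : Function.Injective fun j : ℕ => (0 : ℕ) + 1 + (j : ℤ) := fun i j h => by
    simpa using h
  have := _root_.measure_exists_le_abs_sum_le (X := fun j : ℕ => ε ((0 : ℕ) + 1 + (j : ℤ)))
    (fun i => hε.measurable _) (hε.indep.precomp hinj) (fun i => hε.memLp_two _)
    (fun i => hε.integral_eq_zero _) (fun i => (hε.integral_sq _).le) ha n
  refine le_trans (le_of_eq ?_) this
  congr 1
  ext ω
  have e : ∀ j : ℕ, ∑ i ∈ Finset.Ioc 0 j, ε i ω =
      ∑ i ∈ Finset.range j, ε ((0 : ℕ) + 1 + (i : ℤ)) ω := fun j => by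
    have := sum_Ioc_eq_sum_range_add (fun i => ε i ω) 0 j
    rwa [zero_add] at this
  simp only [Set.mem_ofPred_eq, e]

/-- Read forwards or backwards from any `p`, the innovations are independent and centred with the
same variance, so one `B` serves all `p`. Uniformity matters because the true change-points move
with the sample size. -/
theorem IsIIDNoise.exists_measure_lt_abs_sum_le [IsProbabilityMeasure P]
    (hε : IsIIDNoise P ε) {κ e : ℝ} (hκ : 0 < κ) (he : 0 < e) :
    ∃ B : ℝ, 0 < B ∧ ∀ p : ℕ,
      P {ω | ∃ q, q ≤ p ∧ κ * ((p : ℝ) - q) + B < |∑ i ∈ Finset.Ioc q p, ε i ω|} ≤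
        ENNReal.ofReal e ∧
      P {ω | ∃ q, p ≤ q ∧ κ * ((q : ℝ) - p) + B < |∑ i ∈ Finset.Ioc p q, ε i ω|} ≤
        ENNReal.ofReal e := by
  obtain ⟨B, hB, h⟩ := _root_.exists_measure_lt_abs_sum_le
    (show 0 ≤ ∫ ω, ε 0 ω ^ 2 ∂P from integral_nonneg fun ω => sq_nonneg _) hκ he
  refine ⟨B, hB, fun p => ⟨?_, ?_⟩⟩
  · have hinj : Function.Injective fun j : ℕ => (p : ℤ) - j := fun i j h => by simpa using h
    refine le_trans (measure_mono ?_) (h P (fun j : ℕ => ε ((p : ℤ) - j))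
      (fun i => hε.measurable _) (hε.indep.precomp hinj) (fun i => hε.memLp_two _)
      (fun i => hε.integral_eq_zero _) (fun i => (hε.integral_sq _).le))
    rintro ω ⟨q, hq, hlt⟩
    refine ⟨p - q, ?_⟩
    rw [Nat.cast_sub hq, ← sum_Ioc_eq_sum_range_sub (fun i => ε i ω) (Nat.sub_le p q),
      Nat.sub_sub_self hq]
    exact hlt
  · have hinj : Function.Injective fun j : ℕ => (p : ℤ) + 1 + j := fun i j h => by simpa using h
    refine le_trans (measure_mono ?_) (h P (fun j : ℕ => ε ((p : ℤ) + 1 + j))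
      (fun i => hε.measurable _) (hε.indep.precomp hinj) (fun i => hε.memLp_two _)
      (fun i => hε.integral_eq_zero _) (fun i => (hε.integral_sq _).le))
    rintro ω ⟨q, hq, hlt⟩
    refine ⟨q - p, ?_⟩
    rw [Nat.cast_sub hq, ← sum_Ioc_eq_sum_range_add (fun i => ε i ω), Nat.add_sub_cancel' hq]
    exact hlt

end Noise

theorem exists_pos_forall_le {ι : Type*} [Finite ι] {f : ι → ℝ} (hf : ∀ i, 0 < f i) :
    ∃ d : ℝ, 0 < d ∧ ∀ i, d ≤ f i := by
  rcases isEmpty_or_nonempty ι with h | h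
  · exact ⟨1, one_pos, fun i => isEmptyElim i⟩
  · obtain ⟨i, hi⟩ := Finite.exists_min f
    exact ⟨f i, hf i, hi⟩

/-! ### Rounding of the change-point fractions. -/

section ChangePoint

variable {m : ℕ} {τ : Fin (m + 2) → ℝ}

theorem abs_changePoint_sub_le (hτ : StrictMono τ) (hτ0 : τ 0 = 0) (n : ℕ) (k : Fin (m + 2)) :
    |(changePoint τ n k : ℝ) - n * τ k| ≤ 1 := by
  have h0 : 0 ≤ (n : ℝ) * τ k :=
    mul_nonneg (Nat.cast_nonneg n) (hτ0 ▸ hτ.monotone (Fin.zero_le k))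
  have h1 := Nat.floor_le h0
  have h2 := Nat.lt_floor_add_one ((n : ℝ) * τ k)
  unfold changePoint
  exact abs_le.2 ⟨by linarith, by linarith⟩

theorem changePoint_zero (hτ0 : τ 0 = 0) (n : ℕ) : changePoint τ n 0 = 0 := by
  simp [changePoint, hτ0]

theorem changePoint_last (hτ1 : τ (Fin.last (m + 1)) = 1) (n : ℕ) :
    changePoint τ n (Fin.last (m + 1)) = n := by
  simp [changePoint, hτ1]

theorem exists_changePoint_gap (hτ : StrictMono τ) (hτ0 : τ 0 = 0) :
    ∃ c : ℝ, 0 < c ∧ ∀ᶠ n : ℕ in atTop, ∀ k : Fin (m + 1),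
      c * n ≤ (changePoint τ n k.succ : ℝ) - changePoint τ n k.castSucc := by
  obtain ⟨g, hg, hle⟩ := exists_pos_forall_le (f := fun k : Fin (m + 1) => τ k.succ - τ k.castSucc)
    fun k => sub_pos.2 (hτ (Fin.castSucc_lt_succ))
  -- Rounding costs at most 2 per gap, which is at most half of ng once n ≥ 4/g.
  refine ⟨g / 2, by positivity, ?_⟩
  have hev : ∀ᶠ n : ℕ in atTop, 4 / g ≤ (n : ℝ) :=
    tendsto_natCast_atTop_atTop.eventually_ge_atTop _
  filter_upwards [hev] with n hn k
  rw [div_le_iff₀ hg] at hn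
  have h1 := abs_le.1 (abs_changePoint_sub_le hτ hτ0 n k.succ)
  have h2 := abs_le.1 (abs_changePoint_sub_le hτ hτ0 n k.castSucc)
  have h3 := mul_le_mul_of_nonneg_left (hle k) (Nat.cast_nonneg (α := ℝ) n)
  linarith

end ChangePoint

/-! ### Union bound and the three conclusions. -/

/-- With probability close to one, the estimated change-points are within a bounded distance of the
true ones and the estimated levels are within `O(n^{-1/2})` of the true ones. -/
theorem exists_measure_not_rate_le {Ω : Type*} [MeasurableSpace Ω] (P : Measure Ω)
    [IsProbabilityMeasure P] (m : ℕ)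
    (τ : Fin (m + 2) → ℝ) (hτ : StrictMono τ) (hτ0 : τ 0 = 0) (hτ1 : τ (Fin.last (m + 1)) = 1)
    (μ : Fin (m + 1) → ℝ) (hμ : ∀ k : Fin m, μ k.castSucc ≠ μ k.succ)
    (ρ : ℝ) (hρ : |ρ| < 1) (ε η : ℤ → Ω → ℝ)
    (hε : IsIIDNoise P ε) (hη : IsStationaryAR1 P ρ ε η)
    (y : ℕ → ℕ → Ω → ℝ) (hy : IsObservation τ μ η y)
    (ρbar : ℕ → Ω → ℝ)
    (hρbar : IsBigOP P (fun n ω => ρbar n ω - ρ) (fun n => 1 / Real.sqrt n))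
    (Δ : ℕ → ℝ) (hΔ : Tendsto Δ atTop atTop)
    (hΔτ : ∀ᶠ n in atTop, ∀ k : Fin (m + 1),
      Δ n ≤ (changePoint τ n k.succ : ℝ) - (changePoint τ n k.castSucc : ℝ))
    (δhat : ℕ → Ω → Fin (m + 1) → ℝ) (that : ℕ → Ω → Fin (m + 2) → ℕ)
    (hhat : ∀ᶠ n in atTop, ∀ᵐ ω ∂P,
      IsArgmin n (Δ n) (fun i => y n i ω) (ρbar n ω) (δhat n ω) (that n ω))
    {e : ℝ} (he : 0 < e) :
    ∃ K : ℝ, 0 ≤ K ∧ ∀ᶠ n : ℕ in atTop,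
      P {ω | ¬ ((∀ k, |(that n ω k : ℝ) - changePoint τ n k| ≤ K) ∧
        ∀ k, |δhat n ω k - (1 - ρ) * μ k| ≤ K * (1 / √n))} ≤ ENNReal.ofReal e := by
  have h1ρ : 0 < 1 - |ρ| := by linarith
  obtain ⟨c, hc, hgap⟩ := exists_changePoint_gap hτ hτ0
  obtain ⟨dμ, hdμ0, hdμ⟩ := exists_pos_forall_le
    (f := fun k : Fin m => |μ k.castSucc - μ k.succ|) fun k => abs_pos.2 (sub_ne_zero.2 (hμ k))
  set Cμ : ℝ := ∑ k, |μ k| with hCμdef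
  have hCμ : ∀ k, |μ k| ≤ Cμ := fun k =>
    Finset.single_le_sum (f := fun k => |μ k|) (fun k _ => abs_nonneg _) (Finset.mem_univ k)
  have hCμ0 : 0 ≤ Cμ := (abs_nonneg _).trans (hCμ 0)
  set C : ℝ := 3 * Cμ with hC
  set d : ℝ := dμ * (1 - |ρ|) / 2 with hd
  have hC0 : 0 ≤ C := by positivity
  have hd0 : 0 < d := by positivity
  set κ : ℝ := d ^ 2 / (4 * (2 * C + d)) with hκdef
  have hκ0 : 0 < κ := by positivity
  have hκ : 4 * (2 * C + d) * κ ≤ d ^ 2 := by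
    rw [hκdef, mul_div_cancel₀]
    positivity
  set v : ℝ := ∫ ω, ε 0 ω ^ 2 ∂P with hv
  have hv0 : 0 ≤ v := integral_nonneg fun ω => sq_nonneg _
  -- Kolmogorov's bound is v/A₀², and A₀² ≥ A₀ ≥ 4v/e makes it at most e/4.
  set A₀ : ℝ := 4 * v / e + 1 with hA₀
  have hA₀1 : 1 ≤ A₀ := by
    have : 0 ≤ 4 * v / e := by positivity
    linarith
  obtain ⟨M, hM⟩ := hρbar (e / 4) (by positivity)
  set A₁ : ℝ := max M 0 with hA₁
  have hA₁0 : 0 ≤ A₁ := le_max_right _ _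
  obtain ⟨A₂, hA₂0, hA₂⟩ := exists_measure_lt_abs_le (P := P) (hη.measurable 0)
    (show 0 < e / 4 by positivity)
  -- Two directions at each of `m` change-points: the total is at most e/4.
  obtain ⟨B, hB0, hB⟩ := hε.exists_measure_lt_abs_sum_le hκ0
    (show 0 < e / (8 * (m + 1)) by positivity)
  set R : ℝ := A₁ * ((2 * A₀ + 2 * (A₂ + 2 * A₀ / (1 - |ρ|))) / (1 - |ρ|)) + 4 * Cμ with hR
  have hR0 : 0 ≤ R := by positivity
  obtain ⟨K, hK0, hK⟩ := eventually_forall_isTameSample_rate m hΔ (A := 2 * A₀ + R) (B := B + R)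
    hc hC0 hd0 (by positivity) (by positivity) hκ
  -- The tame sample has levels (1 - ρbar)μ_k; passing to (1 - ρ)μ_k costs A₁Cμ/√n.
  refine ⟨K + A₁ * Cμ, by positivity, ?_⟩
  have hsmall := eventually_sqrt_inv_bounds hΔ (show 0 < (1 - |ρ|) / 2 by positivity) A₁ 0
  filter_upwards [hgap, hΔτ, hhat, hM, hK, hsmall, eventually_ge_atTop 1]
    with n hgap hΔτ hhat hM hK hsmall hn
  have hnR : (1 : ℝ) ≤ n := by exact_mod_cast hn
  have hsq0 : 0 < √(n : ℝ) := by positivity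
  set s := changePoint τ n with hs
  have hsadm : s ∈ admissible m n (Δ n) := by
    refine ⟨changePoint_zero hτ0 n, changePoint_last hτ1 n, fun k => ⟨?_, hΔτ k⟩⟩
    have h1 := hgap k
    have : 0 < c * (n : ℝ) := by positivity
    have h2 : (s k.castSucc : ℝ) < s k.succ := by linarith
    exact_mod_cast h2
  have hrec : ∀ᵐ ω ∂P, ∀ i, η i ω = ρ * η (i - 1) ω + ε i ω := ae_all_iff.2 hη.recursion
  set E₁ : Set Ω := {ω | ¬ (IsArgmin n (Δ n) (fun i => y n i ω) (ρbar n ω) (δhat n ω) (that n ω) ∧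
    ∀ i, η i ω = ρ * η (i - 1) ω + ε i ω)} with hE₁
  set E₂ : Set Ω := {ω | ∃ j ≤ n, A₀ * √n ≤ |∑ i ∈ Finset.Ioc 0 j, ε i ω|} with hE₂
  set E₃ : Set Ω := {ω | A₂ < |η 0 ω|} with hE₃
  set E₄ : Set Ω := {ω | M * (1 / √n) < |ρbar n ω - ρ|} with hE₄
  set F : Fin m → Set Ω := fun k => {ω | ∃ q, q ≤ s k.castSucc.succ ∧
    κ * ((s k.castSucc.succ : ℝ) - q) + B < |∑ i ∈ Finset.Ioc q (s k.castSucc.succ), ε i ω|} with hF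
  set G : Fin m → Set Ω := fun k => {ω | ∃ q, s k.castSucc.succ ≤ q ∧
    κ * ((q : ℝ) - s k.castSucc.succ) + B < |∑ i ∈ Finset.Ioc (s k.castSucc.succ) q, ε i ω|} with hG
  have hP₁ : P E₁ = 0 := by
    have := hhat.and hrec
    rwa [ae_iff] at this
  have hP₂ : P E₂ ≤ ENNReal.ofReal (e / 4) := by
    refine (hε.measure_exists_le_abs_sum_le (by positivity) n).trans
      (ENNReal.ofReal_le_ofReal ?_)
    rw [mul_pow, Real.sq_sqrt (by positivity), mul_comm (A₀ ^ 2), mul_div_mul_left _ _ (by positivity),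
      div_le_iff₀ (by positivity)]
    have h1 : 4 * v / e ≤ A₀ ^ 2 := by nlinarith
    rw [div_le_iff₀ he] at h1
    linarith
  have hP₅ : P (⋃ k, (F k ∪ G k)) ≤ ENNReal.ofReal (e / 4) := by
    refine (measure_iUnion_fintype_le _ _).trans ?_
    have h1 : ∀ k, P (F k ∪ G k) ≤ ENNReal.ofReal (e / (4 * (m + 1))) := by
      intro k
      refine (measure_union_le _ _).trans ((add_le_add (hB _).1 (hB _).2).trans (le_of_eq ?_))
      rw [← ENNReal.ofReal_add (by positivity) (by positivity)]
      congr 1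
      field_simp
      norm_num
    refine (Finset.sum_le_sum fun k _ => h1 k).trans ?_
    rw [Finset.sum_const, Finset.card_univ, Fintype.card_fin, nsmul_eq_mul,
      ← ENNReal.ofReal_natCast, ← ENNReal.ofReal_mul (by positivity)]
    refine ENNReal.ofReal_le_ofReal ?_
    rw [mul_div_assoc', div_le_div_iff₀ (by positivity) (by positivity)]
    nlinarith
  have hincl : {ω | ¬ ((∀ k, |(that n ω k : ℝ) - s k| ≤ K + A₁ * Cμ) ∧
      ∀ k, |δhat n ω k - (1 - ρ) * μ k| ≤ (K + A₁ * Cμ) * (1 / √n))} ⊆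
      E₁ ∪ (E₂ ∪ (E₃ ∪ (E₄ ∪ ⋃ k, (F k ∪ G k)))) := by
    intro ω hω
    by_contra hcon
    simp only [Set.mem_union, not_or, Set.mem_iUnion, not_exists] at hcon
    obtain ⟨h1, h2, h3, h4, h5⟩ := hcon
    obtain ⟨harg, hrecω⟩ := not_not.1 h1
    simp only [hE₂, hE₃, hE₄, Set.mem_ofPred_eq, not_exists, not_and, not_le, not_lt] at h2 h3 h4
    refine hω ?_
    have hρ' : |ρbar n ω - ρ| ≤ A₁ * (1 / √n) :=
      h4.trans (mul_le_mul_of_nonneg_right (le_max_left _ _) (by positivity))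
    have htame : IsTameSample n s (fun k => (1 - ρbar n ω) * μ k)
        (fun i => y n i ω - ρbar n ω * y n (i - 1) ω)
        (fun i => (1 - ρbar n ω) * (y n i ω - η i ω)) c C d (2 * A₀ + R) κ (B + R) := by
      refine isTameSample_of_path (e := fun i => ε i ω) (x := fun i => η i ω)
        (y := fun i => y n i ω) hn hρ ?_ (changePoint_zero hτ0 n) (changePoint_last hτ1 n)
        (fun k => (hsadm.2.2 k).1.le) hgap (hy n ω).1 (hy n ω).2 hCμ hdμ0.le hdμ
        (fun j hj => (h2 j hj).le) h3 hρ' (by linarith) ?_ ?_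
      · intro i
        have := hrecω ((i + 1 : ℕ) : ℤ)
        rwa [show ((i + 1 : ℕ) : ℤ) - 1 = i by push_cast; ring] at this
      · intro k p hp
        by_contra! hlt
        exact (h5 k).1 ⟨p, hp, hlt⟩
      · intro k q hq
        by_contra! hlt
        exact (h5 k).2 ⟨q, hq, hlt⟩
    -- `harg.2` applies because `criterion` unfolds to `rss` of the decorrelated series.
    obtain ⟨ht, hδ⟩ := hK s _ _ _ (δhat n ω) (that n ω) htame hsadm harg.1 harg.2
    have hAC : 0 ≤ A₁ * Cμ := by positivity
    refine ⟨fun k => (ht k).trans (by linarith), fun k => ?_⟩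
    have h6 : |(ρ - ρbar n ω) * μ k| ≤ A₁ * (1 / √n) * Cμ := by
      rw [abs_mul, abs_sub_comm]
      exact mul_le_mul hρ' (hCμ k) (abs_nonneg _) (by positivity)
    calc |δhat n ω k - (1 - ρ) * μ k|
        = |(δhat n ω k - (1 - ρbar n ω) * μ k) + (ρ - ρbar n ω) * μ k| := by
          congr 1
          ring
      _ ≤ K * (1 / √n) + A₁ * (1 / √n) * Cμ := (abs_add_le _ _).trans (add_le_add (hδ k) h6)
      _ = (K + A₁ * Cμ) * (1 / √n) := by ring
  refine (measure_mono hincl).trans ?_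
  calc P (E₁ ∪ (E₂ ∪ (E₃ ∪ (E₄ ∪ ⋃ k, (F k ∪ G k)))))
      ≤ P E₁ + (P E₂ + (P E₃ + (P E₄ + P (⋃ k, (F k ∪ G k))))) :=
        (measure_union_le _ _).trans (add_le_add_right ((measure_union_le _ _).trans
          (add_le_add_right ((measure_union_le _ _).trans
            (add_le_add_right (measure_union_le _ _) _)) _)) _)
    _ ≤ 0 + (ENNReal.ofReal (e / 4) + (ENNReal.ofReal (e / 4) +
          (ENNReal.ofReal (e / 4) + ENNReal.ofReal (e / 4)))) := by
        rw [hP₁]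
        gcongr
    _ = ENNReal.ofReal e := by
        rw [zero_add, ← ENNReal.ofReal_add (by positivity) (by positivity),
          ← ENNReal.ofReal_add (by positivity) (by positivity),
          ← ENNReal.ofReal_add (by positivity) (by positivity)]
        congr 1
        ring

theorem IsBigOP.tendsto_measure_le {Ω : Type*} [MeasurableSpace Ω] {P : Measure Ω}
    {X : ℕ → Ω → ℝ} {a : ℕ → ℝ} (h : IsBigOP P X a) (ha : Tendsto a atTop (𝓝 0)) {x : ℝ}
    (hx : 0 < x) : Tendsto (fun n => P {ω | x ≤ |X n ω|}) atTop (𝓝 0) := by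
  rw [ENNReal.tendsto_nhds_zero]
  intro e he
  obtain ⟨e', he', hle⟩ : ∃ e' : ℝ, 0 < e' ∧ ENNReal.ofReal e' ≤ e := by
    rcases eq_or_ne e ⊤ with rfl | htop
    · exact ⟨1, one_pos, le_top⟩
    · exact ⟨e.toReal, ENNReal.toReal_pos he.ne' htop, (ENNReal.ofReal_toReal htop).le⟩
  obtain ⟨M, hM⟩ := h e' he'
  have hlim : Tendsto (fun n => M * a n) atTop (𝓝 0) := by simpa using ha.const_mul M
  filter_upwards [hM, hlim.eventually_lt_const hx] with n hn1 hn2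
  refine (measure_mono ?_).trans (hn1.trans hle)
  intro ω hω
  exact lt_of_lt_of_le hn2 hω

end AR1Seg

theorem mainTheorem2 {Ω : Type*} [MeasurableSpace Ω] (P : Measure Ω) [IsProbabilityMeasure P]
    (m : ℕ)
    -- true change-point fractions `0 = τ_0 < τ_1 < … < τ_{m+1} = 1`, and true means
    (τ : Fin (m + 2) → ℝ) (hτ : StrictMono τ) (hτ0 : τ 0 = 0) (hτ1 : τ (Fin.last (m + 1)) = 1)
    (μ : Fin (m + 1) → ℝ) (hμ : ∀ k : Fin m, μ k.castSucc ≠ μ k.succ)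
    -- stationary AR(1) errors
    (ρ : ℝ) (hρ : |ρ| < 1) (ε η : ℤ → Ω → ℝ)
    (hε : AR1Seg.IsIIDNoise P ε) (hη : AR1Seg.IsStationaryAR1 P ρ ε η)
    -- observations
    (y : ℕ → ℕ → Ω → ℝ) (hy : AR1Seg.IsObservation τ μ η y)
    -- preliminary estimator of the autocorrelation
    (ρbar : ℕ → Ω → ℝ) (hρbar_meas : ∀ n, Measurable (ρbar n))
    (hρbar : AR1Seg.IsBigOP P (fun n ω => ρbar n ω - ρ) (fun n => 1 / Real.sqrt n))
    -- minimal segment length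
    (Δ : ℕ → ℝ) (hΔ : Tendsto Δ atTop atTop)
    (hΔτ : ∀ᶠ n in atTop, ∀ k : Fin (m + 1),
      Δ n ≤ (AR1Seg.changePoint τ n k.succ : ℝ) - (AR1Seg.changePoint τ n k.castSucc : ℝ))
    -- least-squares estimators: an arbitrary choice of minimizers
    (δhat : ℕ → Ω → Fin (m + 1) → ℝ) (that : ℕ → Ω → Fin (m + 2) → ℕ)
    (hhat : ∀ᶠ n in atTop, ∀ᵐ ω ∂P,
      AR1Seg.IsArgmin n (Δ n) (fun i => y n i ω) (ρbar n ω) (δhat n ω) (that n ω)) :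
    TendstoInMeasure P (fun n ω k => (that n ω k : ℝ) / n) atTop (fun _ => τ) ∧
    AR1Seg.IsBigOP P (fun n ω => ‖(fun k => (that n ω k : ℝ) / n) - τ‖) (fun n => 1 / (n : ℝ)) ∧
    AR1Seg.IsBigOP P
      (fun n ω => ‖WithLp.toLp 2 (fun k => δhat n ω k - (1 - ρ) * μ k)‖)
      (fun n => 1 / Real.sqrt n) := by
  have key := fun {e : ℝ} (he : 0 < e) => AR1Seg.exists_measure_not_rate_le P m τ hτ hτ0 hτ1 μ hμ
    ρ hρ ε η hε hη y hy ρbar hρbar Δ hΔ hΔτ δhat that hhat he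
  have hrate : AR1Seg.IsBigOP P (fun n ω => ‖(fun k => (that n ω k : ℝ) / n) - τ‖)
      (fun n => 1 / (n : ℝ)) := by
    intro e he
    obtain ⟨K, hK0, hK⟩ := key he
    -- The extra 1 is the rounding error of nτ_k.
    refine ⟨K + 1, ?_⟩
    filter_upwards [hK, eventually_ge_atTop 1] with n hn hn1
    refine (measure_mono ?_).trans hn
    intro ω hω hgood
    have hnR : (0 : ℝ) < n := by exact_mod_cast hn1
    refine absurd (Set.mem_ofPred.1 hω) (not_lt.2 ?_)
    rw [abs_norm, pi_norm_le_iff_of_nonneg (by positivity)]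
    intro k
    have h1 := abs_add_le ((that n ω k : ℝ) - AR1Seg.changePoint τ n k)
      (AR1Seg.changePoint τ n k - n * τ k)
    have h2 := AR1Seg.abs_changePoint_sub_le hτ hτ0 n k
    have h3 := hgood.1 k
    rw [Pi.sub_apply, Real.norm_eq_abs, mul_one_div, le_div_iff₀ hnR, ← abs_of_pos hnR, ← abs_mul,
      abs_of_pos hnR, sub_mul, div_mul_cancel₀ _ hnR.ne']
    rw [sub_add_sub_cancel, mul_comm (n : ℝ)] at h1
    rw [mul_comm (n : ℝ)] at h2
    linarith
  refine ⟨?_, hrate, ?_⟩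
  · rw [tendstoInMeasure_iff_norm]
    intro x hx
    have := hrate.tendsto_measure_le tendsto_one_div_atTop_nhds_zero_nat hx
    simpa only [abs_norm] using this
  · intro e he
    obtain ⟨K, hK0, hK⟩ := key he
    -- The Euclidean norm of `m + 1` coordinates is at most √(m + 1) times their largest absolute
    -- value.
    refine ⟨√(m + 1) * K, ?_⟩
    filter_upwards [hK] with n hn
    refine (measure_mono ?_).trans hn
    intro ω hω hgood
    refine absurd (Set.mem_ofPred.1 hω) (not_lt.2 ?_)
    rw [abs_norm, EuclideanSpace.norm_eq, mul_assoc]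
    have hnn : 0 ≤ K * (1 / √(n : ℝ)) := by positivity
    rw [← Real.sqrt_sq hnn, ← Real.sqrt_mul (by positivity)]
    refine Real.sqrt_le_sqrt ?_
    have h1 : ∀ k ∈ (Finset.univ : Finset (Fin (m + 1))),
        ‖δhat n ω k - (1 - ρ) * μ k‖ ^ 2 ≤ (K * (1 / √(n : ℝ))) ^ 2 := fun k _ =>
      pow_le_pow_left₀ (norm_nonneg _) (hgood.2 k) 2
    refine (Finset.sum_le_card_nsmul _ _ _ h1).trans (le_of_eq ?_)
    rw [Finset.card_univ, Fintype.card_fin, nsmul_eq_mul]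
    push_cast
    ring
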